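/- Let $c_0,c_1,c_2,\dots$ be independent identically distributed real random variables with $\mathbb E c_k=0$, $\mathbb E c_k^2=1$, whose common law has a continuous density $r$ with respect to Lebesgue measure, and let $\varphi(s)=\int_{-\infty}^{\infty} r(t)e^{its}\,dt$ be their characteristic function. Assume that $\varphi$ is three times differentiable and that there are $a,A>0$ such that for all $s\in\mathbb R$ $$|\varphi(s)|\le\frac{1}{(1+a s^2)^{3}},\qquad \left|\frac{d^j\varphi(s)}{ds^j}\right|\le\frac{A}{(1+a|s|)^6}\quad (j=1,2,3).$$ For $n\ge 0$ let $$f_n(x)=\sum_{k=0}^n\sqrt{\binom nk}\,c_k x^k,\qquad x\in\mathbb R .$$ Then for every $n$ the number of real zeros of $f_n$ is integrable, and the distribution of the real zeros of $f_n$ has a density $p_n$, that is, a measurable function $p_n\ge 0$ with $\mathbb E\,\#\{x\in B: f_n(x)=0\}=\int_B p_n(x)\,dx$ for every Borel set $B\subseteq\mathbb R$. For any such densities, $p_n$ is integrable for every $n$, and $$\lim_{n\to\infty}\frac{1}{\sqrt n}\int_{-\infty}^{\infty}p_n(x)\,dx=1 .$$ Equivalently, $$\lim_{n\to\infty}\frac{1}{\sqrt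 n}\,\mathbb E\,\#\{x\in\mathbb R: f_n(x)=0\}=1 .$$ -/

import Mathlib

open MeasureTheory ProbabilityTheory Filter Topology

namespace SO2Ensemble

/-- The real polynomial `f_n(x) = ∑_{k=0}^n √(n choose k) c_k x^k` with coefficients `c`. -/
noncomputable def poly (c : ℕ → ℝ) (n : ℕ) (x : ℝ) : ℝ :=
  ∑ k ∈ Finset.range (n + 1), Real.sqrt (n.choose k : ℝ) * c k * x ^ k

/-- The set of real zeros of `f_n`. -/
def realZeros (c : ℕ → ℝ) (n : ℕ) : Set ℝ := {x : ℝ | poly c n x = 0}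

/-- `p` is a density of the distribution of real zeros of the random polynomial `f_n`: for every
Borel set `B`, the expected number of zeros of `f_n` in `B` is `∫_B p(x) dx`. -/
def IsRealZeroDensity {Ω : Type*} [MeasurableSpace Ω] (P : Measure Ω) (c : ℕ → Ω → ℝ) (n : ℕ)
    (p : ℝ → ℝ) : Prop :=
  Measurable p ∧ (∀ x, 0 ≤ p x) ∧
    ∀ B : Set ℝ, MeasurableSet B →
      ∫⁻ ω, ((B ∩ realZeros (fun k => c k ω) n).encard : ENNReal) ∂P =
        ∫⁻ x in B, ENNReal.ofReal (p x)

/-- The conditions on the characteristic function: for some `a, A > 0` and all real `s`,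
`|φ(s)| ≤ (1 + a s²)⁻³`, and `φ` is three times differentiable with
`|φ⁽ʲ⁾(s)| ≤ A (1 + a|s|)⁻⁶` for `j = 1, 2, 3`. -/
def CharFunBounds (φ : ℝ → ℂ) : Prop :=
  (∀ j < 3, Differentiable ℝ (iteratedDeriv j φ)) ∧
    ∃ a > 0, ∃ A > 0, ∀ s : ℝ,
      ‖φ s‖ ≤ 1 / (1 + a * s ^ 2) ^ 3 ∧
        ∀ j ∈ Finset.Icc 1 3, ‖iteratedDeriv j φ s‖ ≤ A / (1 + a * |s|) ^ 6

end SO2Ensemble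

/-! Write `f = c 0 + g` with `g` the sum of the higher terms. For a fixed `g`, the zeros of `f` form
the fibre of `-g` over `c 0`. Integrating over `c 0`, which is independent of `g` and has density
`r`, the one-dimensional area formula shows that the zeros have intensity `E |f'(x)| r(-g(x))`
(`IsEnsemble.lintegral_encard`). This is the density at `0` of `f(x)` weighted by `|f'(x)|`. Because
the density is evaluated where `f(x) = 0`, any multiple `α f(x)` may be subtracted from `f'(x)`;
with `α = n p / x` and `p = x² / (1 + x²)` the two linear forms become uncorrelated.

After normalization their coefficient vectors `ξ, η` are orthonormal, and the `ξ_k²` are the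
binomial weights with parameter `p`. The formula `|y| = absConst⁻¹ ∫ (1 - cos (t y)) / t² dt` turns
the Fourier transform of the weighted density into an integral of second differences of `∏ φ(s ξ_k +
t η_k)`. Fourier inversion at `0` then gives the intensity as `√n / (1 + x²)` times
`fourierIntensity` (`IsEnsemble.intensity_eq_fourierIntensity`).

When `n x²` is large and `|x| ≤ 1`, all the `ξ_k² + η_k²` are small (`exists_coeff_sq_le`). The
joint characteristic function is then close to `exp (-(s² + t²) / 2)`. The cubic decay of `φ`
survives the removal of two factors and supplies an integrable majorant
(`AdmissibleDensity.norm_secondDiff_le`). Hence `fourierIntensity` is bounded and tends to `1 / π`.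
When `n x²` stays bounded, the second moment of `f'(x)` bounds the intensity by a multiple of `√n`.
So the intensity divided by `√n` converges dominatedly on `[-1, 1]` to `1 / (π (1 + x²))`, whose
integral there is `1/2`. The map `x ↦ 1/x` reverses the coefficients, which leaves the ensemble of
the same kind, so the outside of `[-1, 1]` contributes the other half. -/

namespace SO2Ensemble

/-! ### The area formula on the line -/

/-- The area formula in dimension one for a function with nonvanishing derivative. -/
theorem lintegral_mul_encard_fiber_of_deriv_ne_zero {g g' : ℝ → ℝ}
    (hg : ∀ x, HasDerivAt g (g' x) x) {U : Set ℝ}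
    (hU : MeasurableSet U) (hU' : ∀ x ∈ U, g' x ≠ 0) {h : ℝ → ENNReal} (hh : Measurable h) :
    ∫⁻ u, h u * ((U ∩ g ⁻¹' {u}).encard : ENNReal) =
      ∫⁻ x in U, ENNReal.ofReal |g' x| * h (g x) := by
  classical
  rcases U.eq_empty_or_nonempty with rfl | hne
  · simp
  have hgc : Continuous g := continuous_iff_continuousAt.2 fun x => (hg x).continuousAt
  obtain ⟨t, A, hdisj, htm, hcov, happ, hA⟩ :=
    exists_partition_approximatesLinearOn_of_hasFDerivWithinAt g U
      (fun x => ContinuousLinearMap.toSpanSingleton ℝ (g' x))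
      (fun x _ => (hg x).hasFDerivAt.hasFDerivWithinAt)
      (fun A => if A 1 = 0 then 1 else ‖A 1‖₊ / 2)
      (fun A => by split_ifs with h0 <;> simp [h0])
  have hinj : ∀ n, Set.InjOn g (U ∩ t n) := by
    intro n x hx y hy hxy
    obtain ⟨z, hz, hAz⟩ := hA hne n
    have h1 : A n 1 = g' z := by simp [hAz]
    have h2 : A n 1 ≠ 0 := by rw [h1]; exact hU' z hz
    have h3 := (happ n) x hx y hy
    rw [if_neg h2, hxy] at h3
    have h4 : A n (x - y) = (x - y) * A n 1 := by
      rw [← smul_eq_mul, ← map_smul]; simp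
    have h5 : (0:ℝ) < |A n 1| := abs_pos.2 h2
    simp only [sub_self, zero_sub, norm_neg, h4, norm_mul, Real.norm_eq_abs, NNReal.coe_div,
      coe_nnnorm, NNReal.coe_ofNat] at h3
    have h6 : |x - y| ≤ 0 := by nlinarith [abs_nonneg (x - y)]
    exact sub_eq_zero.1 (abs_nonpos_iff.1 h6)
  have hTm : ∀ n, MeasurableSet (U ∩ t n) := fun n => hU.inter (htm n)
  have hUT : U = ⋃ n, U ∩ t n := by
    rw [← Set.inter_iUnion, Set.inter_eq_left.2 hcov]
  have hTd : Pairwise (Function.onFun Disjoint fun n => U ∩ t n) := fun i j hij =>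
    (hdisj hij).mono Set.inter_subset_right Set.inter_subset_right
  have him : ∀ n, MeasurableSet (g '' (U ∩ t n)) := fun n =>
    (hTm n).image_of_continuousOn_injOn hgc.continuousOn (hinj n)
  -- Each piece meets the fibre in at most one point, so the fibre is counted by the pieces whose
  -- image contains `u`.
  have hcount : ∀ u, ((U ∩ g ⁻¹' {u}).encard : ENNReal) =
      ∑' n, (g '' (U ∩ t n)).indicator (fun _ => (1 : ENNReal)) u := by
    intro u
    have hmu : MeasurableSet (g ⁻¹' {u}) := hgc.measurable (measurableSet_singleton u)
    rw [← Measure.count_apply (hU.inter hmu)]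
    conv_lhs => rw [hUT, Set.iUnion_inter]
    rw [measure_iUnion (fun i j hij => (hTd hij).mono Set.inter_subset_left Set.inter_subset_left)
      (fun n => (hTm n).inter hmu)]
    refine tsum_congr fun n => ?_
    by_cases hu : u ∈ g '' (U ∩ t n)
    · obtain ⟨x, hx, rfl⟩ := hu
      have : U ∩ t n ∩ g ⁻¹' {g x} = {x} := by
        ext y
        constructor
        · rintro ⟨hy, hy'⟩
          exact hinj n hy hx hy'
        · rintro rfl
          exact ⟨hx, rfl⟩
      rw [this, Measure.count_singleton, Set.indicator_of_mem (Set.mem_image_of_mem g hx)]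
    · have : U ∩ t n ∩ g ⁻¹' {u} = ∅ := by
        ext y
        simp only [Set.mem_empty_iff_false, iff_false]
        rintro ⟨hy, hy'⟩
        exact hu ⟨y, hy, hy'⟩
      rw [this, measure_empty, Set.indicator_of_notMem hu]
  calc ∫⁻ u, h u * ((U ∩ g ⁻¹' {u}).encard : ENNReal)
      = ∫⁻ u, ∑' n, (g '' (U ∩ t n)).indicator h u := by
        refine lintegral_congr fun u => ?_
        rw [hcount, ← ENNReal.tsum_mul_left]
        refine tsum_congr fun n => ?_
        by_cases hu : u ∈ g '' (U ∩ t n) <;> simp [hu]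
    _ = ∑' n, ∫⁻ u in g '' (U ∩ t n), h u := by
        rw [lintegral_tsum fun n => (hh.indicator (him n)).aemeasurable]
        exact tsum_congr fun n => lintegral_indicator (him n) h
    _ = ∑' n, ∫⁻ x in U ∩ t n, ENNReal.ofReal |g' x| * h (g x) :=
        tsum_congr fun n => lintegral_image_eq_lintegral_abs_deriv_mul (hTm n)
          (fun x _ => (hg x).hasDerivWithinAt) (hinj n) h
    _ = ∫⁻ x in U, ENNReal.ofReal |g' x| * h (g x) := by
        rw [← lintegral_iUnion hTm hTd, ← hUT]

/-- The area formula in dimension one. -/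
theorem lintegral_mul_encard_fiber {g g' : ℝ → ℝ}
    (hg : ∀ x, HasDerivAt g (g' x) x) {B : Set ℝ}
    (hB : MeasurableSet B) {h : ℝ → ENNReal} (hh : Measurable h) :
    ∫⁻ u, h u * ((B ∩ g ⁻¹' {u}).encard : ENNReal) =
      ∫⁻ x in B, ENNReal.ofReal |g' x| * h (g x) := by
  have hg'm : Measurable g' := by
    have : g' = deriv g := funext fun x => (hg x).deriv.symm
    rw [this]; exact measurable_deriv g
  have hZ : MeasurableSet {x | g' x ≠ 0} := (hg'm (measurableSet_singleton 0)).compl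
  -- Sard: critical values are null, so discarding critical points alters the fibres over a null set
  -- only. On the other side their factor `|g'|` is zero.
  have hcrit : volume (g '' {x | g' x = 0}) = 0 :=
    addHaar_image_eq_zero_of_det_fderivWithin_eq_zero volume
      (f' := fun x => ContinuousLinearMap.toSpanSingleton ℝ (g' x))
      (fun x _ => (hg x).hasFDerivAt.hasFDerivWithinAt)
      (fun x hx => by
        have : g' x = 0 := hx
        simp [this])
  have hae : ∀ᵐ u, u ∉ g '' {x | g' x = 0} := by
    rw [ae_iff]; simpa only [not_not, Set.ofPred_mem_eq] using hcrit
  have h1 : ∫⁻ u, h u * ((B ∩ g ⁻¹' {u}).encard : ENNReal) =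
      ∫⁻ u, h u * (((B ∩ {x | g' x ≠ 0}) ∩ g ⁻¹' {u}).encard : ENNReal) := by
    refine lintegral_congr_ae ?_
    filter_upwards [hae] with u hu
    have : B ∩ g ⁻¹' {u} = (B ∩ {x | g' x ≠ 0}) ∩ g ⁻¹' {u} := by
      ext x
      constructor
      · rintro ⟨hx, hxu⟩
        exact ⟨⟨hx, fun h0 => hu ⟨x, h0, hxu⟩⟩, hxu⟩
      · rintro ⟨⟨hx, -⟩, hxu⟩
        exact ⟨hx, hxu⟩
    rw [← this]
  rw [h1, lintegral_mul_encard_fiber_of_deriv_ne_zero hg (hB.inter hZ) (fun x hx => hx.2) hh,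
    Set.inter_comm, ← Measure.restrict_restrict hZ]
  refine setLIntegral_eq_of_support_subset ?_ 
  intro x hx h0
  apply hx
  simp [h0]

/-! ### Measurability of zero counts -/

/-- The zeros on a compact set depend measurably on the parameter. -/
theorem isClosed_setOf_exists_zero {E : Type*} [TopologicalSpace E] {F : E → ℝ → ℝ}
    (hF : Continuous (Function.uncurry F)) {K : Set ℝ} (hK : IsCompact K) :
    IsClosed {e : E | ∃ x ∈ K, F e x = 0} := by
  have : CompactSpace K := isCompact_iff_compactSpace.1 hK
  have hcl : IsClosed {q : E × K | F q.1 q.2 = 0} :=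
    isClosed_eq (hF.comp (continuous_fst.prodMk (continuous_subtype_val.comp continuous_snd)))
      continuous_const
  -- Projection along a compact factor is a closed map.
  convert isClosedMap_fst_of_compactSpace _ hcl using 1
  ext e
  constructor
  · rintro ⟨x, hx, h0⟩
    exact ⟨(e, ⟨x, hx⟩), h0, rfl⟩
  · rintro ⟨⟨e', x⟩, h0, rfl⟩
    exact ⟨x, x.2, h0⟩

/-- A half-open interval is a countable union of compact ones. Half-open intervals are needed
because the dyadic cells must partition the line. -/
theorem measurableSet_setOf_exists_zero_Ioc {E : Type*} [TopologicalSpace E] [MeasurableSpace E]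
    [BorelSpace E] {F : E → ℝ → ℝ} (hF : Continuous (Function.uncurry F)) (a b : ℝ) :
    MeasurableSet {e : E | ∃ x ∈ Set.Ioc a b, F e x = 0} := by
  have : {e : E | ∃ x ∈ Set.Ioc a b, F e x = 0} =
      ⋃ m : ℕ, {e : E | ∃ x ∈ Set.Icc (a + 1 / ((m : ℝ) + 1)) b, F e x = 0} := by
    ext e
    simp only [Set.mem_ofPred_eq, Set.mem_iUnion]
    constructor
    · rintro ⟨x, ⟨hax, hxb⟩, h0⟩
      obtain ⟨m, hm⟩ := exists_nat_one_div_lt (sub_pos.2 hax)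
      exact ⟨m, x, ⟨by linarith, hxb⟩, h0⟩
    · rintro ⟨m, x, ⟨hax, hxb⟩, h0⟩
      have : (0:ℝ) < 1 / ((m : ℝ) + 1) := by positivity
      exact ⟨x, ⟨by linarith, hxb⟩, h0⟩
  rw [this]
  exact MeasurableSet.iUnion fun m => (isClosed_setOf_exists_zero hF isCompact_Icc).measurableSet

/-- A finite set is eventually separated by the dyadic partitions of the line. -/
theorem eventually_injOn_ceil_two_pow {S : Set ℝ} (hS : S.Finite) :
    ∀ᶠ m : ℕ in atTop, Set.InjOn (fun x : ℝ => ⌈x * 2 ^ m⌉) S := by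
  have key : ∀ x ∈ S, ∀ y ∈ S, ∀ᶠ m : ℕ in atTop, ⌈x * 2 ^ m⌉ = ⌈y * 2 ^ m⌉ → x = y := by
    intro x _ y _
    rcases eq_or_ne x y with rfl | hne
    · simp
    have hpos : 0 < |x - y| := abs_pos.2 (sub_ne_zero.2 hne)
    have ht : Tendsto (fun m : ℕ => |x - y| * (2:ℝ) ^ m) atTop atTop :=
      (tendsto_pow_atTop_atTop_of_one_lt (by norm_num)).const_mul_atTop hpos
    filter_upwards [ht.eventually_ge_atTop 1] with m hm heq
    exfalso
    have h1 := Int.ceil_lt_add_one (x * (2:ℝ) ^ m)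
    have h2 := Int.le_ceil (x * (2:ℝ) ^ m)
    have h3 := Int.ceil_lt_add_one (y * (2:ℝ) ^ m)
    have h4 := Int.le_ceil (y * (2:ℝ) ^ m)
    rw [heq] at h1 h2
    have h5 : |(x - y) * (2:ℝ) ^ m| < 1 := by
      rw [abs_lt]; constructor <;> nlinarith
    rw [abs_mul, abs_of_pos (by positivity : (0:ℝ) < 2 ^ m)] at h5
    linarith
  have := (hS.eventually_all (l := atTop) (p := fun x (m : ℕ) => ∀ y ∈ S, ⌈x * (2:ℝ) ^ m⌉ = ⌈y * 2 ^ m⌉ → x = y)).2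
    fun x hx => (hS.eventually_all).2 fun y hy => key x hx y hy
  filter_upwards [this] with m hm x hx y hy hxy using hm x hx y hy hxy

theorem mem_Ioc_iff_ceil_eq (m : ℕ) (j : ℤ) (x : ℝ) :
    ⌈x * 2 ^ m⌉ = j ↔ x ∈ Set.Ioc (((j : ℝ) - 1) / 2 ^ m) ((j : ℝ) / 2 ^ m) := by
  have : (0:ℝ) < 2 ^ m := by positivity
  rw [Int.ceil_eq_iff, Set.mem_Ioc, div_lt_iff₀ this, le_div_iff₀ this]

/-- The number of zeros in a half-line is a measurable function of the parameter. -/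
theorem measurable_encard_zeros_Iic {E : Type*} [TopologicalSpace E] [MeasurableSpace E]
    [BorelSpace E] {F : E → ℝ → ℝ} (hF : Continuous (Function.uncurry F))
    (hfin : ∀ e, {x | F e x = 0}.Finite) (a : ℝ) :
    Measurable fun e => ((Set.Iic a ∩ {x | F e x = 0}).encard : ENNReal) := by
  classical
  -- The number of dyadic cells, cut off at `a`, that contain a zero. It equals the number of zeros
  -- once the cells separate them.
  have hmeas : ∀ m : ℕ, Measurable fun e => ∑' j : ℤ,
      {e : E | ∃ x ∈ Set.Ioc (((j : ℝ) - 1) / 2 ^ m) (min ((j : ℝ) / 2 ^ m) a), F e x = 0}.indicator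
        (fun _ => (1 : ENNReal)) e := fun m =>
    Measurable.tsum fun j =>
      measurable_const.indicator (measurableSet_setOf_exists_zero_Ioc hF _ _)
  refine measurable_of_tendsto_metrizable hmeas ?_
  rw [tendsto_pi_nhds]
  intro e
  set S := Set.Iic a ∩ {x | F e x = 0} with hSdef
  have hS : S.Finite := (hfin e).subset Set.inter_subset_right
  refine tendsto_const_nhds.congr' ?_
  filter_upwards [eventually_injOn_ceil_two_pow hS] with m hm
  have h1 : ∀ j : ℤ, ({e : E | ∃ x ∈ Set.Ioc (((j : ℝ) - 1) / 2 ^ m) (min ((j : ℝ) / 2 ^ m) a), F e x = 0}.indicator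
        (fun _ => (1 : ENNReal)) e) =
      ((fun x : ℝ => ⌈x * 2 ^ m⌉) '' S).indicator (fun _ => (1 : ENNReal)) j := by
    intro j
    have : (e ∈ {e : E | ∃ x ∈ Set.Ioc (((j : ℝ) - 1) / 2 ^ m) (min ((j : ℝ) / 2 ^ m) a), F e x = 0}) ↔
        j ∈ ((fun x : ℝ => ⌈x * 2 ^ m⌉) '' S) := by
      simp only [Set.mem_ofPred_eq, Set.mem_image, hSdef, Set.mem_inter_iff, Set.mem_Iic,
        mem_Ioc_iff_ceil_eq, Set.mem_Ioc, le_min_iff]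
      constructor
      · rintro ⟨x, ⟨h1, h2, h3⟩, h0⟩
        exact ⟨x, ⟨h3, h0⟩, h1, h2⟩
      · rintro ⟨x, ⟨h3, h0⟩, h1, h2⟩
        exact ⟨x, ⟨h1, h2, h3⟩, h0⟩
    simp only [Set.indicator, this]
  rw [tsum_congr h1, ← hm.encard_image, ← Measure.count_apply (MeasurableSet.of_discrete),
    ← lintegral_count, lintegral_indicator MeasurableSet.of_discrete]
  simp

/-- The number of zeros in a Borel set is a measurable function of the parameter. -/
theorem measurable_encard_zeros {E : Type*} [TopologicalSpace E] [MeasurableSpace E]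
    [BorelSpace E] {F : E → ℝ → ℝ} (hF : Continuous (Function.uncurry F))
    (hfin : ∀ e, {x | F e x = 0}.Finite) {B : Set ℝ} (hB : MeasurableSet B) :
    Measurable fun e => ((B ∩ {x | F e x = 0}).encard : ENNReal) := by
  have happ : ∀ e, ∀ B : Set ℝ, MeasurableSet B →
      (Measure.count.restrict {x | F e x = 0}) B = ((B ∩ {x | F e x = 0}).encard : ENNReal) := by
    intro e B hB
    rw [Measure.restrict_apply hB, Measure.count_apply (hB.inter (hfin e).measurableSet)]
  have : ∀ e, IsFiniteMeasure (Measure.count.restrict {x | F e x = 0}) := fun e => by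
    refine ⟨?_⟩
    rw [Measure.restrict_apply_univ]
    exact Measure.count_apply_lt_top.2 (hfin e)
  -- Counting measure on the zero set is a finite measure depending on the parameter, so
  -- measurability extends from the half-lines, a generating π-system, to Borel sets. The total mass
  -- is a separate requirement, met by exhausting the line with half-lines.
  have hk : Measurable fun e => (Measure.count.restrict {x | F e x = 0} : Measure ℝ) := by
    refine Measurable.measure_of_isPiSystem (S := Set.range Set.Iic)
      ((BorelSpace.measurable_eq (α := ℝ)).trans (borel_eq_generateFrom_Iic ℝ)) ?_ ?_ ?_
    · exact isPiSystem_Iic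
    · rintro _ ⟨a, rfl⟩
      simp_rw [happ _ _ measurableSet_Iic]
      exact measurable_encard_zeros_Iic hF hfin a
    · have hlim : ∀ e, Tendsto (fun m : ℕ => (Measure.count.restrict {x | F e x = 0}) (Set.Iic (m : ℝ)))
          atTop (𝓝 ((Measure.count.restrict {x | F e x = 0}) Set.univ)) := by
        intro e
        have hU : (Set.univ : Set ℝ) = ⋃ m : ℕ, Set.Iic (m : ℝ) := by
          ext x
          simp [exists_nat_ge x]
        rw [hU]
        exact tendsto_measure_iUnion_atTop fun i j hij =>
          Set.Iic_subset_Iic.2 (by exact_mod_cast hij)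
      refine measurable_of_tendsto_metrizable (f := fun (m : ℕ) e =>
        (Measure.count.restrict {x | F e x = 0}) (Set.Iic (m : ℝ))) ?_ (tendsto_pi_nhds.2 hlim)
      intro m
      simp_rw [happ _ _ measurableSet_Iic]
      exact measurable_encard_zeros_Iic hF hfin m
  have := (Measure.measurable_coe hB).comp hk
  simpa only [Function.comp_def, happ _ _ hB] using this

end SO2Ensemble

/-! ### The ensemble and the intensity of its zeros -/

namespace SO2Ensemble

/-- The law with density `r`. -/
noncomputable def law (r : ℝ → ℝ) : Measure ℝ := volume.withDensity fun t => ENNReal.ofReal (r t)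

/-- Standardized continuous densities whose characteristic function has the decay of
`CharFunBounds`. -/
structure AdmissibleDensity (r : ℝ → ℝ) (a : ℝ) : Prop where
  cont : Continuous r
  nonneg : ∀ t, 0 ≤ r t
  prob : IsProbabilityMeasure (law r)
  memLp : MemLp id 2 (law r)
  mean : ∫ t, t ∂law r = 0
  second : ∫ t, t ^ 2 ∂law r = 1
  a_pos : 0 < a
  bound : ∀ s, ‖charFun (law r) s‖ ≤ 1 / (1 + a * s ^ 2) ^ 3

/-- Independent random variables with common density `r`. -/
structure IsEnsemble {Ω : Type*} [MeasurableSpace Ω] (P : Measure Ω) (c : ℕ → Ω → ℝ)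
    (r : ℝ → ℝ) : Prop where
  meas : ∀ k, Measurable (c k)
  indep : iIndepFun c P
  law_eq : ∀ k, P.map (c k) = law r

/-- The coefficients of index `1, …, n`, the others being replaced by zero. -/
noncomputable def tail (n : ℕ) (c : ℕ → ℝ) (k : ℕ) : ℝ := if k ∈ Finset.Icc 1 n then c k else 0

/-- The derivative of `poly c n`. -/
noncomputable def polyDeriv (c : ℕ → ℝ) (n : ℕ) (x : ℝ) : ℝ :=
  ∑ k ∈ Finset.range (n + 1), Real.sqrt (n.choose k : ℝ) * c k * (k * x ^ (k - 1))

theorem hasDerivAt_poly (c : ℕ → ℝ) (n : ℕ) (x : ℝ) :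
    HasDerivAt (poly c n) (polyDeriv c n x) x := by
  unfold poly polyDeriv
  exact HasDerivAt.fun_sum fun k _ => (hasDerivAt_pow k x).const_mul _

theorem poly_eq_add_tail (c : ℕ → ℝ) (n : ℕ) (x : ℝ) :
    poly c n x = c 0 + poly (tail n c) n x := by
  unfold poly
  rw [Finset.sum_range_succ', Finset.sum_range_succ']
  have : ∀ k ∈ Finset.range n, tail n c (k + 1) = c (k + 1) := fun k hk => by
    rw [tail, if_pos]
    simp only [Finset.mem_range] at hk
    simp; omega
  rw [Finset.sum_congr rfl fun k hk => congrArg (fun y => _ * y * x ^ (k + 1)) (this k hk)]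
  simp [tail, add_comm]

theorem polyDeriv_tail (c : ℕ → ℝ) (n : ℕ) (x : ℝ) :
    polyDeriv (tail n c) n x = polyDeriv c n x := by
  unfold polyDeriv
  rw [Finset.sum_range_succ', Finset.sum_range_succ']
  have : ∀ k ∈ Finset.range n, tail n c (k + 1) = c (k + 1) := fun k hk => by
    rw [tail, if_pos]
    simp only [Finset.mem_range] at hk
    simp; omega
  rw [Finset.sum_congr rfl fun k hk =>
    congrArg (fun y => _ * y * (((k + 1 : ℕ) : ℝ) * x ^ (k + 1 - 1))) (this k hk)]
  simp

theorem tail_tail (n : ℕ) (c : ℕ → ℝ) : tail n (tail n c) = tail n c := by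
  funext k
  unfold tail
  split_ifs <;> rfl

theorem continuous_tail (n : ℕ) : Continuous (tail n) := by
  refine continuous_pi fun k => ?_
  unfold tail
  split_ifs
  · exact continuous_apply k
  · exact continuous_const

theorem continuous_poly (n : ℕ) : Continuous fun q : (ℕ → ℝ) × ℝ => poly q.1 n q.2 := by
  unfold poly
  fun_prop

theorem continuous_polyDeriv (n : ℕ) :
    Continuous fun q : (ℕ → ℝ) × ℝ => polyDeriv q.1 n q.2 := by
  unfold polyDeriv
  fun_prop

/-- A polynomial with nonzero constant coefficient has at most `n` zeros. -/
theorem encard_realZeros_le {c : ℕ → ℝ} (hc : c 0 ≠ 0) (n : ℕ) :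
    (realZeros c n).encard ≤ n := by
  classical
  set p : Polynomial ℝ := ∑ k ∈ Finset.range (n + 1),
    Polynomial.C (Real.sqrt (n.choose k : ℝ) * c k) * Polynomial.X ^ k with hp
  have heval : ∀ x, p.eval x = poly c n x := by
    intro x
    simp [hp, poly, Polynomial.eval_finsetSum]
  have hne : p ≠ 0 := by
    intro h0
    have := heval 0
    rw [h0, Polynomial.eval_zero, poly, Finset.sum_range_succ'] at this
    simp at this
    exact hc this.symm
  have hdeg : p.natDegree ≤ n := by
    refine Polynomial.natDegree_sum_le_of_forall_le _ _ fun k hk => ?_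
    refine (Polynomial.natDegree_C_mul_X_pow_le _ _).trans ?_
    simpa [Nat.lt_succ_iff] using hk
  have hsub : realZeros c n ⊆ (p.roots.toFinset : Set ℝ) := by
    intro x hx
    have hx' : poly c n x = 0 := hx
    simp [hne, Polynomial.IsRoot, heval, hx']
  calc (realZeros c n).encard ≤ ((p.roots.toFinset : Set ℝ)).encard := Set.encard_le_encard hsub
    _ = (p.roots.toFinset.card : ℕ∞) := Set.encard_coe_eq_coe_finsetCard _
    _ ≤ n := by
      exact_mod_cast (p.roots.toFinset_card_le).trans (p.card_roots'.trans hdeg)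

/-- Number of zeros in `B` of the polynomial with constant coefficient `q.1` and higher
coefficients `q.2`; it is set to zero when the constant coefficient vanishes. -/
noncomputable def zeroCount (n : ℕ) (B : Set ℝ) (q : ℝ × (ℕ → ℝ)) : ENNReal :=
  if q.1 = 0 then 0 else ((B ∩ {x | q.1 + poly (tail n q.2) n x = 0}).encard : ENNReal)

theorem setOf_add_poly_tail (n : ℕ) (c : ℕ → ℝ) :
    {x | c 0 + poly (tail n c) n x = 0} = realZeros c n := by
  ext x
  simp [realZeros, poly_eq_add_tail c n x]

theorem finite_setOf_add_poly_tail {v : ℝ} (hv : v ≠ 0) (z : ℕ → ℝ) (n : ℕ) :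
    {x | v + poly (tail n z) n x = 0}.Finite := by
  set c : ℕ → ℝ := fun k => if k = 0 then v else z k with hc
  have h0 : c 0 ≠ 0 := by simpa [hc] using hv
  have ht : tail n c = tail n z := by
    funext k
    unfold tail
    split_ifs with hk
    · have : k ≠ 0 := by simp at hk; omega
      simp [hc, this]
    · rfl
  have : {x | v + poly (tail n z) n x = 0} = realZeros c n := by
    rw [← setOf_add_poly_tail, ht]; simp [hc]
  rw [this]
  exact Set.finite_of_encard_le_coe (encard_realZeros_le h0 n)

/-- Away from `q.1 = 0` the polynomial is not the zero polynomial, so its zero set is finite and the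
preceding measurability result applies; on `q.1 = 0` the default value is constant. -/
theorem measurable_zeroCount (n : ℕ) {B : Set ℝ} (hB : MeasurableSet B) :
    Measurable (zeroCount n B) := by
  have hs : MeasurableSet {q : ℝ × (ℕ → ℝ) | q.1 = 0} :=
    measurable_fst (measurableSet_singleton 0)
  set S : Set (ℝ × (ℕ → ℝ)) := {q | q.1 = 0} with hS
  refine measurable_of_restrict_of_restrict_compl hs ?_ ?_
  · have : S.domRestrict (zeroCount n B) = fun _ => 0 := by
      funext q
      have : q.1.1 = 0 := q.2
      simp [zeroCount, this]
    rw [this]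
    exact measurable_const
  · have hF : Continuous (Function.uncurry fun (e : (Sᶜ : Set _)) (x : ℝ) =>
        e.1.1 + poly (tail n e.1.2) n x) := by
      have h1 : Continuous fun e : (Sᶜ : Set _) × ℝ =>
          ((tail n e.1.1.2, e.2) : (ℕ → ℝ) × ℝ) :=
        ((continuous_tail n).comp (continuous_snd.comp
          (continuous_subtype_val.comp continuous_fst))).prodMk continuous_snd
      exact (continuous_fst.comp (continuous_subtype_val.comp continuous_fst)).add
        ((continuous_poly n).comp h1)
    have hne : ∀ e : (Sᶜ : Set _), e.1.1 ≠ 0 := fun e => e.2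
    have := measurable_encard_zeros hF (fun e => finite_setOf_add_poly_tail (hne e) e.1.2 n) hB
    convert this using 1
    funext e
    simp only [Set.domRestrict_apply, zeroCount, if_neg (hne e)]

section Ensemble

variable {Ω : Type*} [MeasurableSpace Ω] {P : Measure Ω}
  {c : ℕ → Ω → ℝ} {r : ℝ → ℝ} {a : ℝ}

theorem IsEnsemble.measurable_coeff (hc : IsEnsemble P c r) :
    Measurable fun ω k => c k ω := measurable_pi_lambda _ hc.meas

theorem IsEnsemble.measurable_tail (hc : IsEnsemble P c r) (n : ℕ) :
    Measurable fun ω => tail n fun k => c k ω :=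
  (continuous_tail n).measurable.comp hc.measurable_coeff

theorem IsEnsemble.indepFun_tail (hc : IsEnsemble P c r) (n : ℕ) :
    IndepFun (c 0) (fun ω => tail n fun k => c k ω) P := by
  classical
  have h := hc.indep.indepFun_finset {0} (Finset.Icc 1 n) (by simp) hc.meas
  have h1 : Measurable fun z : (({0} : Finset ℕ) → ℝ) => z ⟨0, by simp⟩ := measurable_pi_apply _
  have h2 : Measurable fun (z : (Finset.Icc 1 n) → ℝ) (k : ℕ) =>
      if hk : k ∈ Finset.Icc 1 n then z ⟨k, hk⟩ else 0 := by
    refine measurable_pi_lambda _ fun k => ?_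
    split_ifs with hk
    · exact measurable_pi_apply _
    · exact measurable_const
  have h3 := h.comp h1 h2
  have h4 : (fun ω => tail n fun k => c k ω) = (fun (z : (Finset.Icc 1 n) → ℝ) (k : ℕ) =>
      if hk : k ∈ Finset.Icc 1 n then z ⟨k, hk⟩ else 0) ∘ fun ω i => c i ω := by
    funext ω k
    simp [tail]
  rw [h4]
  exact h3

/-- Integration over the constant coefficient. -/
theorem IsEnsemble.lintegral_split [IsProbabilityMeasure P] (hc : IsEnsemble P c r) (hr : AdmissibleDensity r a) (n : ℕ)
    {F : ℝ × (ℕ → ℝ) → ENNReal} (hF : Measurable F) :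
    ∫⁻ ω, F (c 0 ω, tail n fun k => c k ω) ∂P =
      ∫⁻ ω, (∫⁻ v : ℝ, ENNReal.ofReal (r v) * F (v, tail n fun k => c k ω)) ∂P := by
  have hp := hr.prob
  have hT := hc.measurable_tail n
  have hpm := (indepFun_iff_map_prod_eq_prod_map_map (hc.meas 0).aemeasurable
    hT.aemeasurable).1 (hc.indepFun_tail n)
  have : IsProbabilityMeasure (P.map fun ω => tail n fun k => c k ω) :=
    Measure.isProbabilityMeasure_map hT.aemeasurable
  rw [hc.law_eq 0] at hpm
  rw [← lintegral_map hF ((hc.meas 0).prodMk hT), hpm, lintegral_prod_symm _ hF.aemeasurable,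
    lintegral_map (Measurable.lintegral_prod_left' hF) hT]
  refine lintegral_congr fun ω => ?_
  exact lintegral_withDensity_eq_lintegral_mul _ hr.cont.measurable.ennreal_ofReal
    (hF.comp (by fun_prop : Measurable fun v : ℝ => (v, tail n fun k => c k ω)))

theorem IsEnsemble.ae_ne_zero (hc : IsEnsemble P c r) (k : ℕ) : ∀ᵐ ω ∂P, c k ω ≠ 0 := by
  have h : P.map (c k) {0} = 0 := by
    rw [hc.law_eq k]
    exact withDensity_absolutelyContinuous _ _ (by simp)
  rw [Measure.map_apply (hc.meas k) (measurableSet_singleton 0)] at h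
  rw [ae_iff]
  simp only [not_not]
  exact h

/-- The law of `c 0` has no atom at `0`, so the default value in `zeroCount` is invisible. -/
theorem IsEnsemble.zeroCount_ae_eq (hc : IsEnsemble P c r) (n : ℕ) (B : Set ℝ) :
    (fun ω => ((B ∩ realZeros (fun k => c k ω) n).encard : ENNReal)) =ᵐ[P]
      fun ω => zeroCount n B (c 0 ω, tail n fun k => c k ω) := by
  filter_upwards [hc.ae_ne_zero 0] with ω hω
  rw [zeroCount, if_neg hω, tail_tail, ← setOf_add_poly_tail]

theorem IsEnsemble.aemeasurable_encard (hc : IsEnsemble P c r) (n : ℕ) {B : Set ℝ}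
    (hB : MeasurableSet B) :
    AEMeasurable (fun ω => ((B ∩ realZeros (fun k => c k ω) n).encard : ENNReal)) P :=
  ((measurable_zeroCount n hB).comp ((hc.meas 0).prodMk (hc.measurable_tail n))).aemeasurable.congr
    (hc.zeroCount_ae_eq n B).symm

/-- The intensity of the real zeros. -/
noncomputable def intensity (P : Measure Ω) (c : ℕ → Ω → ℝ) (r : ℝ → ℝ) (n : ℕ) (x : ℝ) : ENNReal :=
  ∫⁻ ω, ENNReal.ofReal |polyDeriv (fun k => c k ω) n x| *
    ENNReal.ofReal (r (-poly (tail n fun k => c k ω) n x)) ∂P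

theorem IsEnsemble.measurable_intensity_integrand (hc : IsEnsemble P c r)
    (hr : AdmissibleDensity r a) (n : ℕ) :
    Measurable fun q : Ω × ℝ => ENNReal.ofReal |polyDeriv (fun k => c k q.1) n q.2| *
      ENNReal.ofReal (r (-poly (tail n fun k => c k q.1) n q.2)) := by
  have h1 : Measurable fun q : Ω × ℝ => polyDeriv (fun k => c k q.1) n q.2 :=
    (continuous_polyDeriv n).measurable.comp
      ((hc.measurable_coeff.comp measurable_fst).prodMk measurable_snd)
  have h2 : Measurable fun q : Ω × ℝ => poly (tail n fun k => c k q.1) n q.2 :=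
    (continuous_poly n).measurable.comp
      (((hc.measurable_tail n).comp measurable_fst).prodMk measurable_snd)
  exact h1.abs.ennreal_ofReal.mul (hr.cont.measurable.comp h2.neg).ennreal_ofReal

theorem IsEnsemble.measurable_intensity [SFinite P] (hc : IsEnsemble P c r)
    (hr : AdmissibleDensity r a) (n : ℕ) : Measurable (intensity P c r n) :=
  Measurable.lintegral_prod_left' (hc.measurable_intensity_integrand hr n)

/-- The expected number of zeros in a Borel set is the integral of the intensity. -/
theorem IsEnsemble.lintegral_encard [IsProbabilityMeasure P] (hc : IsEnsemble P c r) (hr : AdmissibleDensity r a) (n : ℕ)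
    {B : Set ℝ} (hB : MeasurableSet B) :
    ∫⁻ ω, ((B ∩ realZeros (fun k => c k ω) n).encard : ENNReal) ∂P =
      ∫⁻ x in B, intensity P c r n x := by
  rw [lintegral_congr_ae (hc.zeroCount_ae_eq n B), hc.lintegral_split hr n (measurable_zeroCount n hB)]
  unfold intensity
  rw [lintegral_lintegral_swap (f := fun x ω => ENNReal.ofReal |polyDeriv (fun k => c k ω) n x| *
    ENNReal.ofReal (r (-poly (tail n fun k => c k ω) n x)))
    ((hc.measurable_intensity_integrand hr n).comp measurable_swap).aemeasurable]
  refine lintegral_congr fun ω => ?_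
  -- With the tail frozen, the zeros for constant coefficient `v` are the fibre of `g` over `v`; the
  -- area formula is applied with weight `r`.
  set g : ℝ → ℝ := fun x => -poly (tail n fun k => c k ω) n x with hg
  have hgd : ∀ x, HasDerivAt g (-polyDeriv (fun k => c k ω) n x) x := fun x => by
    rw [← polyDeriv_tail]
    exact (hasDerivAt_poly _ n x).neg
  have := lintegral_mul_encard_fiber hgd hB (h := fun v => ENNReal.ofReal (r v))
    hr.cont.measurable.ennreal_ofReal
  simp only [abs_neg] at this
  rw [← this]
  refine lintegral_congr_ae ?_
  have hne : ∀ᵐ v : ℝ, v ≠ 0 := by simp [ae_iff]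
  filter_upwards [hne] with v hv
  rw [zeroCount, if_neg hv, tail_tail]
  congr 4
  ext x
  simp only [hg, Set.mem_ofPred_eq, Set.mem_preimage, Set.mem_singleton_iff]
  constructor <;> intro h <;> linarith

end Ensemble

end SO2Ensemble

/-! ### Moments and uniform smallness of binomial weights -/

namespace SO2Ensemble

/-- The binomial weights. -/
noncomputable def binom (n : ℕ) (p : ℝ) (k : ℕ) : ℝ := n.choose k * p ^ k * (1 - p) ^ (n - k)

section Binomial

variable {p : ℝ}

theorem binom_nonneg (hp : 0 ≤ p) (hp' : p ≤ 1) (n k : ℕ) : 0 ≤ binom n p k := by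
  have : 0 ≤ 1 - p := by linarith
  unfold binom
  positivity

theorem binom_eq_zero {n k : ℕ} (h : n < k) : binom n p k = 0 := by
  simp [binom, Nat.choose_eq_zero_of_lt h]

theorem sum_binom (n : ℕ) (p : ℝ) : ∑ k ∈ Finset.range (n + 1), binom n p k = 1 := by
  have := add_pow p (1 - p) n
  rw [add_sub_cancel, one_pow] at this
  rw [this]
  exact Finset.sum_congr rfl fun k _ => by unfold binom; ring

theorem binom_succ (n k : ℕ) :
    binom (n + 1) p (k + 1) = p * binom n p k + (1 - p) * binom n p (k + 1) := by
  rcases lt_trichotomy k n with h | rfl | h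
  · obtain ⟨d, rfl⟩ := Nat.exists_eq_add_of_lt h
    unfold binom
    rw [Nat.choose_succ_succ, show k + d + 1 + 1 - (k + 1) = d + 1 by omega,
      show k + d + 1 - k = d + 1 by omega, show k + d + 1 - (k + 1) = d by omega]
    push_cast
    ring
  · simp [binom, pow_succ, mul_comm]
  · rw [binom_eq_zero (by omega), binom_eq_zero h, binom_eq_zero (by omega)]
    simp

theorem succ_mul_binom_succ (n k : ℕ) :
    ((k : ℝ) + 1) * binom (n + 1) p (k + 1) = ((n : ℝ) + 1) * p * binom n p k := by
  have h : ((n : ℝ) + 1) * n.choose k = (n + 1).choose (k + 1) * ((k : ℝ) + 1) := by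
    exact_mod_cast Nat.add_one_mul_choose_eq n k
  unfold binom
  rw [Nat.add_sub_add_right]
  calc _ = ((n + 1).choose (k + 1) * ((k : ℝ) + 1)) * (p ^ (k + 1) * (1 - p) ^ (n - k)) := by ring
    _ = _ := by rw [← h]; ring

theorem sum_mul_binom_succ (n : ℕ) :
    ∑ k ∈ Finset.range (n + 2), (k : ℝ) * binom (n + 1) p k = ((n : ℝ) + 1) * p := by
  rw [Finset.sum_range_succ']
  simp only [Nat.cast_add, Nat.cast_one, succ_mul_binom_succ, Nat.cast_zero, zero_mul, add_zero]
  rw [← Finset.mul_sum, sum_binom, mul_one]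

theorem sum_mul_binom (n : ℕ) :
    ∑ k ∈ Finset.range (n + 1), (k : ℝ) * binom n p k = n * p := by
  cases n with
  | zero => simp
  | succ n => push_cast; exact sum_mul_binom_succ n

theorem sum_sq_mul_binom (n : ℕ) :
    ∑ k ∈ Finset.range (n + 1), (k : ℝ) ^ 2 * binom n p k = n * p * (1 - p) + (n * p) ^ 2 := by
  cases n with
  | zero => simp
  | succ n =>
    rw [Finset.sum_range_succ']
    have : ∀ k : ℕ, ((k + 1 : ℕ) : ℝ) ^ 2 * binom (n + 1) p (k + 1) =
        ((n : ℝ) + 1) * p * ((k : ℝ) * binom n p k + binom n p k) := fun k => by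
      push_cast
      rw [sq, mul_assoc, succ_mul_binom_succ]; ring
    simp only [this]
    rw [← Finset.mul_sum, Finset.sum_add_distrib, sum_binom, sum_mul_binom]
    push_cast
    ring

theorem sum_sub_mul_binom (n : ℕ) :
    ∑ k ∈ Finset.range (n + 1), ((k : ℝ) - n * p) * binom n p k = 0 := by
  simp only [sub_mul, Finset.sum_sub_distrib, ← Finset.mul_sum, sum_mul_binom, sum_binom]
  ring

theorem sum_sub_sq_mul_binom (n : ℕ) :
    ∑ k ∈ Finset.range (n + 1), ((k : ℝ) - n * p) ^ 2 * binom n p k = n * p * (1 - p) := by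
  have : ∀ k : ℕ, ((k : ℝ) - n * p) ^ 2 * binom n p k =
      (k : ℝ) ^ 2 * binom n p k - 2 * (n * p) * ((k : ℝ) * binom n p k) +
        (n * p) ^ 2 * binom n p k := fun k => by ring
  simp only [this, Finset.sum_add_distrib, Finset.sum_sub_distrib, ← Finset.mul_sum,
    sum_mul_binom, sum_binom, sum_sq_mul_binom]
  ring

/-- De Moivre's identity: absorption and Pascal's rule make the centred terms telescope. It
expresses a single weight as a truncated first central moment. -/
theorem sum_range_sub_mul_binom (n m : ℕ) :
    ∑ k ∈ Finset.range (m + 1), (((n : ℝ) + 1) * p - k) * binom (n + 1) p k =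
      ((n : ℝ) + 1) * p * (1 - p) * binom n p m := by
  induction m with
  | zero => simp [binom, pow_succ]; ring
  | succ m ih =>
    rw [Finset.sum_range_succ, ih]
    have h1 := succ_mul_binom_succ (p := p) n m
    have h2 := binom_succ (p := p) n m
    push_cast
    have : (((n : ℝ) + 1) * p - (m + 1)) * binom (n + 1) p (m + 1) =
        ((n : ℝ) + 1) * p * binom (n + 1) p (m + 1) - ((n : ℝ) + 1) * p * binom n p m := by
      rw [← h1]; ring
    rw [this, h2]
    ring

/-- By the previous identity the variance times a weight is at most a first absolute central moment,
hence at most a standard deviation `s`. The comparison of moments is `y ≤ s / 2 + y² / (2 s)`,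
summed against the weights. -/
theorem mul_binom_pred_le (hp : 0 < p) (hp' : p < 1) (n m : ℕ) (hm : m ≤ n) :
    Real.sqrt (((n : ℝ) + 1) * p * (1 - p)) * binom n p m ≤ 1 := by
  set V := ((n : ℝ) + 1) * p * (1 - p) with hV
  have hVpos : 0 < V := by
    have : 0 < 1 - p := by linarith
    positivity
  set s := Real.sqrt V with hs
  have hspos : 0 < s := Real.sqrt_pos.2 hVpos
  have hss : s * s = V := Real.mul_self_sqrt hVpos.le
  have hvar := sum_sub_sq_mul_binom (p := p) (n + 1)
  have hsum := sum_binom (n + 1) p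
  push_cast at hvar
  have key : V * binom n p m ≤ s := by
    rw [hV, ← sum_range_sub_mul_binom]
    calc ∑ k ∈ Finset.range (m + 1), (((n : ℝ) + 1) * p - k) * binom (n + 1) p k
        ≤ ∑ k ∈ Finset.range (m + 1),
            (s / 2 * binom (n + 1) p k +
              1 / (2 * s) * (((k : ℝ) - ((n : ℝ) + 1) * p) ^ 2 * binom (n + 1) p k)) := by
          refine Finset.sum_le_sum fun k _ => ?_
          have hb := binom_nonneg hp.le hp'.le (n + 1) k
          rw [← mul_assoc, ← add_mul]
          refine mul_le_mul_of_nonneg_right ?_ hb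
          rw [div_add' _ _ _ (by norm_num), le_div_iff₀ (by norm_num)]
          have : (((n : ℝ) + 1) * p - k) * 2 * s ≤ s * s + ((k : ℝ) - ((n : ℝ) + 1) * p) ^ 2 := by
            nlinarith [sq_nonneg (s - (((n : ℝ) + 1) * p - k))]
          have h2 : 1 / (2 * s) * ((k : ℝ) - ((n : ℝ) + 1) * p) ^ 2 * 2 =
              ((k : ℝ) - ((n : ℝ) + 1) * p) ^ 2 / s := by field_simp
          rw [h2, ← sub_nonneg]
          have h3 : s + ((k : ℝ) - ((n : ℝ) + 1) * p) ^ 2 / s - (((n : ℝ) + 1) * p - k) * 2 =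
              (s * s + ((k : ℝ) - ((n : ℝ) + 1) * p) ^ 2 - (((n : ℝ) + 1) * p - k) * 2 * s) / s := by
            field_simp
          rw [h3]
          exact div_nonneg (by linarith) hspos.le
      _ ≤ ∑ k ∈ Finset.range (n + 1 + 1),
            (s / 2 * binom (n + 1) p k +
              1 / (2 * s) * (((k : ℝ) - ((n : ℝ) + 1) * p) ^ 2 * binom (n + 1) p k)) := by
          refine Finset.sum_le_sum_of_subset_of_nonneg ?_ fun k _ _ => ?_
          · exact Finset.range_subset_range.2 (by omega)
          · have hb := binom_nonneg hp.le hp'.le (n + 1) k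
            positivity
      _ = s := by
          rw [Finset.sum_add_distrib, ← Finset.mul_sum, ← Finset.mul_sum, hsum, hvar, ← hV, ← hss]
          field_simp
          norm_num
  have : s * (s * binom n p m) ≤ s * 1 := by rw [← mul_assoc, hss, mul_one]; exact key
  exact le_of_mul_le_mul_left this hspos

/-- The local bound for binomial weights. -/
theorem sqrt_mul_binom_le (hp : 0 < p) (hp' : p < 1) {n m : ℕ} (hm : m ≤ n) :
    Real.sqrt (n * p * (1 - p)) * binom n p m ≤ 1 := by
  cases n with
  | zero => simp
  | succ n =>
    have key : ∀ j, Real.sqrt (((n : ℝ) + 1) * p * (1 - p)) * binom n p j ≤ 1 := by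
      intro j
      rcases le_or_gt j n with h | h
      · exact mul_binom_pred_le hp hp' n j h
      · rw [binom_eq_zero h]; simp
    push_cast
    -- In `key` the variance belongs to `n + 1` but the weights to `n`; Pascal's rule writes a
    -- weight for `n + 1` as a convex combination of such weights.
    cases m with
    | zero =>
      have h0 : binom (n + 1) p 0 = (1 - p) * binom n p 0 := by simp [binom, pow_succ, mul_comm]
      have := key 0
      have hb := binom_nonneg hp.le hp'.le n 0
      rw [h0]
      have h1 : 0 ≤ Real.sqrt (((n : ℝ) + 1) * p * (1 - p)) * binom n p 0 := by positivity
      nlinarith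
    | succ m =>
      rw [binom_succ]
      nlinarith [key m, key (m + 1)]

theorem sum_binom_mul_exp (n : ℕ) (l : ℝ) :
    ∑ k ∈ Finset.range (n + 1), binom n p k * Real.exp (l * k) = (1 - p + p * Real.exp l) ^ n := by
  rw [add_comm (1 - p), add_pow]
  refine Finset.sum_congr rfl fun k _ => ?_
  rw [mul_pow, ← Real.exp_nat_mul, binom, mul_comm l]
  ring

/-- A Chernoff bound for one weight: a single term is at most the whole exponential moment. For `l²
= 1 / V` with `V` the variance, `exp l - 1 - l ≤ l²` leaves the exponent `n p l² = 1 / (1 - p) ≤ 2`.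
Both signs of `l` are allowed. -/
theorem binom_mul_exp_le (hp : 0 < p) (hp' : p ≤ 1 / 2) {n k : ℕ} (hk : k ≤ n)
    (hV : 1 ≤ n * p * (1 - p)) {l : ℝ} (hl : l ^ 2 = 1 / (n * p * (1 - p))) :
    binom n p k * Real.exp (l * (k - n * p)) ≤ Real.exp 2 := by
  have hq : 0 < 1 - p := by linarith
  have hb : ∀ j, 0 ≤ binom n p j * Real.exp (l * j) := fun j =>
    mul_nonneg (binom_nonneg hp.le (by linarith) n j) (Real.exp_nonneg _)
  have h1 : binom n p k * Real.exp (l * k) ≤ (1 - p + p * Real.exp l) ^ n := by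
    rw [← sum_binom_mul_exp]
    exact Finset.single_le_sum (f := fun j : ℕ => binom n p j * Real.exp (l * j))
      (fun j _ => hb j) (Finset.mem_range.2 (by omega))
  have h2 : (1 - p + p * Real.exp l) ≤ Real.exp (p * (Real.exp l - 1)) := by
    have := Real.add_one_le_exp (p * (Real.exp l - 1))
    linarith
  have h3 : (1 - p + p * Real.exp l) ^ n ≤ Real.exp (n * (p * (Real.exp l - 1))) := by
    rw [Real.exp_nat_mul]
    exact pow_le_pow_left₀ (by positivity) h2 n
  have hl1 : |l| ≤ 1 := by
    rw [← sq_le_one_iff_abs_le_one, hl]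
    exact (div_le_one (by linarith)).2 hV
  have h4 := (abs_le.1 (Real.abs_exp_sub_one_sub_id_le hl1)).2
  have hn : 0 < (n : ℝ) * p := by
    by_contra h
    nlinarith
  calc binom n p k * Real.exp (l * (k - n * p))
      = binom n p k * Real.exp (l * k) * Real.exp (-(l * (n * p))) := by
        rw [mul_assoc, ← Real.exp_add]; ring_nf
    _ ≤ Real.exp (n * (p * (Real.exp l - 1))) * Real.exp (-(l * (n * p))) :=
        mul_le_mul_of_nonneg_right (h1.trans h3) (Real.exp_nonneg _)
    _ = Real.exp (n * p * (Real.exp l - 1 - l)) := by rw [← Real.exp_add]; ring_nf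
    _ ≤ Real.exp 2 := by
        refine Real.exp_le_exp.2 ?_
        calc (n : ℝ) * p * (Real.exp l - 1 - l) ≤ n * p * l ^ 2 :=
              mul_le_mul_of_nonneg_left h4 hn.le
          _ = 1 / (1 - p) := by
            rw [hl, mul_one_div, div_mul_eq_div_div, div_self hn.ne']
          _ ≤ 2 := by rw [div_le_iff₀ hq]; linarith

/-- Binomial weights, even weighted with the square of the standardized variable, are uniformly
small when the variance is large. -/
theorem exists_binom_mul_le {δ : ℝ} (hδ : 0 < δ) :
    ∃ V₀ : ℝ, 1 ≤ V₀ ∧ ∀ (p : ℝ) (n k : ℕ), 0 < p → p ≤ 1 / 2 → V₀ ≤ n * p * (1 - p) → k ≤ n →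
      binom n p k * (1 + (k - n * p) ^ 2 / (n * p * (1 - p))) ≤ δ := by
  -- With `s` the standard deviation and `z = |k - n p| / s`, the weight satisfies `b ≤ 1 / s`, and
  -- `b z⁴ ≤ 8 · 24 = 192` from `b exp z ≤ 8` and `z⁴ / 24 ≤ exp z`. So `(b z²)² ≤ 192 / s`. The two
  -- summands of `M` make `b` and `b z²` at most `δ / 2` each.
  set M : ℝ := max 1 (2 / δ + 192 * 4 / δ ^ 2) with hM
  refine ⟨M ^ 2, ?_, ?_⟩
  · have : 1 ≤ M := le_max_left _ _
    nlinarith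
  intro p n k hp hp' hVM hk
  have hM1 : 1 ≤ M := le_max_left _ _
  set V : ℝ := n * p * (1 - p) with hV
  have hV1 : 1 ≤ V := by nlinarith
  set s := Real.sqrt V with hs
  have hspos : 0 < s := Real.sqrt_pos.2 (by linarith)
  have hss : s * s = V := Real.mul_self_sqrt (by linarith)
  have hsM : M ≤ s := Real.le_sqrt_of_sq_le hVM
  set b := binom n p k with hb
  have hb0 : 0 ≤ b := binom_nonneg hp.le (by linarith) n k
  have hb1 : b ≤ 1 / s := by
    rw [le_div_iff₀ hspos, mul_comm]
    exact sqrt_mul_binom_le hp (by linarith) hk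
  set y : ℝ := k - n * p with hy
  have hl : (1 / s) ^ 2 = 1 / V := by rw [div_pow, sq s, hss]; norm_num
  have hl' : (-(1 / s)) ^ 2 = 1 / V := by rw [neg_sq, hl]
  have h1 := binom_mul_exp_le hp hp' hk hV1 hl
  have h2 := binom_mul_exp_le hp hp' hk hV1 hl'
  rw [← hy, ← hb] at h1 h2
  set z : ℝ := |y| / s with hz
  have hz0 : 0 ≤ z := by positivity
  have hzz : z ^ 2 = y ^ 2 / V := by rw [hz, div_pow, sq_abs, sq s, hss]
  have h3 : b * Real.exp z ≤ 8 := by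
    have he : Real.exp 2 ≤ 8 := by
      have := Real.exp_one_lt_d9
      have h5 : Real.exp 2 = Real.exp 1 * Real.exp 1 := by rw [← Real.exp_add]; norm_num
      rw [h5]; nlinarith [Real.exp_pos 1]
    rcases abs_cases y with ⟨hh, _⟩ | ⟨hh, _⟩
    · rw [hz, hh, div_eq_inv_mul, ← one_div]; linarith
    · rw [hz, hh, div_eq_inv_mul, ← one_div]
      rw [neg_mul] at h2
      rw [mul_neg]; linarith
  have h4 : z ^ 4 / 24 ≤ Real.exp z := by
    have := Real.pow_div_factorial_le_exp z hz0 4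
    norm_num [Nat.factorial] at this
    exact this
  have h5 : b * z ^ 4 ≤ 192 := by nlinarith
  have h6 : (b * z ^ 2) ^ 2 ≤ (δ / 2) ^ 2 := by
    have : (b * z ^ 2) ^ 2 = b * (b * z ^ 4) := by ring
    rw [this]
    have h7 : 192 * 4 / δ ^ 2 ≤ s := by
      have h8 : 2 / δ + 192 * 4 / δ ^ 2 ≤ M := le_max_right _ _
      have h9 : 0 < 2 / δ := by positivity
      linarith
    have h10 : b * (b * z ^ 4) ≤ 1 / s * 192 := by
      refine mul_le_mul hb1 h5 (by positivity) (by positivity)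
    refine h10.trans ?_
    rw [div_le_iff₀ (by positivity)] at h7
    rw [one_div, inv_mul_le_iff₀ hspos]
    nlinarith
  have h7 : b * z ^ 2 ≤ δ / 2 := by
    refine abs_le_of_sq_le_sq' h6 (by positivity) |>.2
  have h8 : b ≤ δ / 2 := by
    refine hb1.trans ?_
    have h8 : 2 / δ + 192 * 4 / δ ^ 2 ≤ M := le_max_right _ _
    have h9 : 0 < 192 * 4 / δ ^ 2 := by positivity
    have h10 : 2 / δ ≤ s := by linarith
    rw [div_le_iff₀ hδ] at h10
    rw [div_le_iff₀ hspos]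
    linarith
  rw [← hzz]
  linarith

end Binomial

end SO2Ensemble

/-! ### Joint characteristic functions: decay, second differences, Gaussian limit -/

namespace SO2Ensemble

/-- Orthonormal pairs of coefficient vectors. -/
structure Frame (S : Finset ℕ) (ξ η : ℕ → ℝ) : Prop where
  left : ∑ k ∈ S, ξ k ^ 2 = 1
  right : ∑ k ∈ S, η k ^ 2 = 1
  cross : ∑ k ∈ S, ξ k * η k = 0

/-- The joint characteristic function of `∑ ξ k * c k` and `∑ η k * c k`. -/
noncomputable def jointChar (r : ℝ → ℝ) (S : Finset ℕ) (ξ η : ℕ → ℝ) (s t : ℝ) : ℂ :=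
  ∏ k ∈ S, charFun (law r) (s * ξ k + t * η k)

/-- The weighted second difference of the joint characteristic function in its second variable. -/
noncomputable def secondDiff (r : ℝ → ℝ) (S : Finset ℕ) (ξ η : ℕ → ℝ) (s t : ℝ) : ℂ :=
  (jointChar r S ξ η s 0 - (jointChar r S ξ η s t + jointChar r S ξ η s (-t)) / 2) / (t : ℂ) ^ 2

theorem one_add_sum_le_prod {ι : Type*} (T : Finset ι) {f : ι → ℝ} (hf : ∀ i ∈ T, 0 ≤ f i) :
    1 + ∑ i ∈ T, f i ≤ ∏ i ∈ T, (1 + f i) := by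
  classical
  induction T using Finset.induction_on with
  | empty => simp
  | insert i T hi ih =>
    rw [Finset.sum_insert hi, Finset.prod_insert hi]
    have h1 := ih fun j hj => hf j (Finset.mem_insert_of_mem hj)
    have h2 := hf i (Finset.mem_insert_self _ _)
    have h3 : 0 ≤ ∑ j ∈ T, f j := Finset.sum_nonneg fun j hj => hf j (Finset.mem_insert_of_mem hj)
    nlinarith

theorem norm_prod_sub_prod_le_sum {ι : Type*} (T : Finset ι) {f g : ι → ℂ}
    (hf : ∀ i ∈ T, ‖f i‖ ≤ 1) (hg : ∀ i ∈ T, ‖g i‖ ≤ 1) :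
    ‖∏ i ∈ T, f i - ∏ i ∈ T, g i‖ ≤ ∑ i ∈ T, ‖f i - g i‖ := by
  classical
  induction T using Finset.induction_on with
  | empty => simp
  | insert i T hi ih =>
    rw [Finset.sum_insert hi, Finset.prod_insert hi, Finset.prod_insert hi]
    have h1 := ih (fun j hj => hf j (Finset.mem_insert_of_mem hj))
      (fun j hj => hg j (Finset.mem_insert_of_mem hj))
    have h2 : ‖∏ j ∈ T, f j‖ ≤ 1 := by
      rw [norm_prod]
      exact Finset.prod_le_one (fun _ _ => norm_nonneg _)
        fun j hj => hf j (Finset.mem_insert_of_mem hj)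
    have h3 := hg i (Finset.mem_insert_self _ _)
    calc ‖f i * ∏ j ∈ T, f j - g i * ∏ j ∈ T, g j‖
        = ‖(f i - g i) * ∏ j ∈ T, f j + g i * (∏ j ∈ T, f j - ∏ j ∈ T, g j)‖ := by ring_nf
      _ ≤ ‖f i - g i‖ * ‖∏ j ∈ T, f j‖ + ‖g i‖ * ‖∏ j ∈ T, f j - ∏ j ∈ T, g j‖ := by
          refine (norm_add_le _ _).trans ?_
          rw [norm_mul, norm_mul]
      _ ≤ ‖f i - g i‖ * 1 + 1 * ∑ j ∈ T, ‖f j - g j‖ := by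
          gcongr
      _ = _ := by ring

section Density

variable {r : ℝ → ℝ} {a : ℝ}

theorem AdmissibleDensity.contDiff (hr : AdmissibleDensity r a) :
    ContDiff ℝ 2 (charFun (law r)) := by
  have := hr.prob
  exact_mod_cast contDiff_charFun (n := 2) (by exact_mod_cast hr.memLp)

theorem AdmissibleDensity.hasDerivAt (hr : AdmissibleDensity r a) (u : ℝ) :
    HasDerivAt (charFun (law r)) (deriv (charFun (law r)) u) u :=
  (hr.contDiff.differentiable (by norm_num) u).hasDerivAt

theorem AdmissibleDensity.hasDerivAt_deriv (hr : AdmissibleDensity r a) (u : ℝ) :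
    HasDerivAt (deriv (charFun (law r))) (iteratedDeriv 2 (charFun (law r)) u) u := by
  have h := hr.contDiff.differentiable_iteratedDeriv 1 (by norm_num) u
  rw [iteratedDeriv_succ, iteratedDeriv_one]
  rw [iteratedDeriv_one] at h
  exact h.hasDerivAt

theorem AdmissibleDensity.norm_deriv_two_le (hr : AdmissibleDensity r a) (u : ℝ) :
    ‖iteratedDeriv 2 (charFun (law r)) u‖ ≤ 1 := by
  have := hr.prob
  rw [iteratedDeriv_charFun (by exact_mod_cast hr.memLp), norm_mul]
  simp only [norm_pow, Complex.norm_I, one_pow, one_mul]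
  refine (norm_integral_le_integral_norm _).trans ?_
  rw [← hr.second]
  refine le_of_eq (integral_congr_ae (ae_of_all _ fun x => ?_))
  have : (u : ℂ) * x * Complex.I = ((u * x : ℝ) : ℂ) * Complex.I := by push_cast; ring
  simp only [norm_mul, this, Complex.norm_exp_ofReal_mul_I, mul_one, norm_pow, Complex.norm_real,
    Real.norm_eq_abs, sq_abs]

theorem AdmissibleDensity.deriv_zero (hr : AdmissibleDensity r a) :
    deriv (charFun (law r)) 0 = 0 := by
  have := hr.prob
  rw [← iteratedDeriv_one, iteratedDeriv_charFun_zero (hr.memLp.mono_exponent (by norm_num))]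
  simp [hr.mean]

/-- The derivative vanishes at `0` because the mean is zero, and it is 1-Lipschitz because the
second moment is one. -/
theorem AdmissibleDensity.norm_deriv_le (hr : AdmissibleDensity r a) (u : ℝ) :
    ‖deriv (charFun (law r)) u‖ ≤ |u| := by
  have := Convex.norm_image_sub_le_of_norm_hasDerivWithin_le (s := Set.univ)
    (fun x _ => (hr.hasDerivAt_deriv x).hasDerivWithinAt)
    (fun x _ => hr.norm_deriv_two_le x) convex_univ (Set.mem_univ 0) (Set.mem_univ u)
  simpa [hr.deriv_zero] using this

theorem AdmissibleDensity.norm_le_one (hr : AdmissibleDensity r a) (u : ℝ) :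
    ‖charFun (law r) u‖ ≤ 1 := by
  have := hr.prob
  exact norm_charFun_le_one u

/-- A centred law of unit variance and the standard Gaussian have the same second-order Taylor
expansion at `0`. -/
theorem AdmissibleDensity.isLittleO_gaussian (hr : AdmissibleDensity r a) :
    (fun u : ℝ => charFun (law r) u - Complex.exp (-(u : ℂ) ^ 2 / 2)) =o[𝓝 0] fun u => u ^ 2 := by
  have := hr.prob
  have h1 : (fun t : ℝ => charFun (law r) t - (1 - (t : ℂ) ^ 2 / 2)) =o[𝓝 0] fun t => t ^ 2 := by
    have := taylor_charFun_two (P := law r) (X := id) aemeasurable_id (by simpa using hr.mean)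
      (by simpa using hr.second)
    simpa using this
  have h2 : (fun t : ℝ => Complex.exp (-(t : ℂ) ^ 2 / 2) - (1 - (t : ℂ) ^ 2 / 2))
      =o[𝓝 0] fun t => t ^ 2 := by
    have hv : ∫ x, x ^ 2 ∂gaussianReal 0 1 = 1 := by
      have h3 := variance_id_gaussianReal (μ := 0) (v := 1)
      rw [variance_eq_sub (memLp_id_gaussianReal 2)] at h3
      simpa using h3
    have := taylor_charFun_two (P := gaussianReal 0 1) (X := id) aemeasurable_id (by simp)
      (by simpa using hv)
    simpa [charFun_gaussianReal, neg_div] using this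
  refine (h1.sub h2).congr_left fun t => ?_
  ring

section Frame

variable {S : Finset ℕ} {ξ η : ℕ → ℝ}

theorem Frame.sum_sq (hF : Frame S ξ η) (s t : ℝ) :
    ∑ k ∈ S, (s * ξ k + t * η k) ^ 2 = s ^ 2 + t ^ 2 := by
  have : ∀ k, (s * ξ k + t * η k) ^ 2 =
      s ^ 2 * ξ k ^ 2 + 2 * s * t * (ξ k * η k) + t ^ 2 * η k ^ 2 := fun k => by ring
  simp only [this, Finset.sum_add_distrib, ← Finset.mul_sum, hF.left, hF.right, hF.cross]
  ring

theorem sq_add_mul_le (s t x y : ℝ) : (s * x + t * y) ^ 2 ≤ (s ^ 2 + t ^ 2) * (x ^ 2 + y ^ 2) := by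
  nlinarith [sq_nonneg (s * y - t * x)]

/-- The decay of the product of characteristic functions with at most two factors removed. -/
theorem AdmissibleDensity.norm_prod_le (hr : AdmissibleDensity r a) (hF : Frame S ξ η)
    (hsmall : ∀ k ∈ S, ξ k ^ 2 + η k ^ 2 ≤ 1 / 4) (s t : ℝ) {T : Finset ℕ} (hT : T ⊆ S)
    (hcard : (S \ T).card ≤ 2) :
    ‖∏ k ∈ T, charFun (law r) (s * ξ k + t * η k)‖ ≤ 1 / (1 + a / 2 * (s ^ 2 + t ^ 2)) ^ 3 := by
  have ha := hr.a_pos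
  set u : ℕ → ℝ := fun k => s * ξ k + t * η k with hu
  -- Orthonormality makes the squares `u k ^ 2` add up to `s² + t²`. By the bound `1/4` each removed
  -- index carries at most a quarter of this, so two removals leave at least half, whence the
  -- constant `a / 2`.
  have h1 : ∑ k ∈ S \ T, u k ^ 2 ≤ (s ^ 2 + t ^ 2) / 2 := by
    calc ∑ k ∈ S \ T, u k ^ 2 ≤ ∑ k ∈ S \ T, (s ^ 2 + t ^ 2) / 4 := by
          refine Finset.sum_le_sum fun k hk => ?_
          have h2 := sq_add_mul_le s t (ξ k) (η k)
          have h3 := hsmall k (Finset.mem_sdiff.1 hk).1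
          have h4 : 0 ≤ s ^ 2 + t ^ 2 := by positivity
          simp only [hu]
          nlinarith
      _ = (S \ T).card * ((s ^ 2 + t ^ 2) / 4) := by rw [Finset.sum_const, nsmul_eq_mul]
      _ ≤ 2 * ((s ^ 2 + t ^ 2) / 4) := by
          refine mul_le_mul_of_nonneg_right ?_ (by positivity)
          exact_mod_cast hcard
      _ = _ := by ring
  have h2 : (s ^ 2 + t ^ 2) / 2 ≤ ∑ k ∈ T, u k ^ 2 := by
    have h3 := Finset.sum_sdiff (f := fun k => u k ^ 2) hT
    have h4 := hF.sum_sq s t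
    simp only [hu] at h1 h3 ⊢
    linarith
  have h3 : 1 + a / 2 * (s ^ 2 + t ^ 2) ≤ ∏ k ∈ T, (1 + a * u k ^ 2) := by
    refine le_trans ?_ (one_add_sum_le_prod T fun k _ => by positivity)
    rw [← Finset.mul_sum]
    nlinarith
  rw [norm_prod]
  calc ∏ k ∈ T, ‖charFun (law r) (u k)‖ ≤ ∏ k ∈ T, 1 / (1 + a * u k ^ 2) ^ 3 :=
        Finset.prod_le_prod (fun _ _ => norm_nonneg _) fun k _ => hr.bound _
    _ = 1 / (∏ k ∈ T, (1 + a * u k ^ 2)) ^ 3 := by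
        rw [Finset.prod_div_distrib, Finset.prod_const_one, Finset.prod_pow]
    _ ≤ _ := by
        have : 0 < 1 + a / 2 * (s ^ 2 + t ^ 2) := by positivity
        gcongr

theorem AdmissibleDensity.hasDerivAt_prod (hr : AdmissibleDensity r a) (T : Finset ℕ)
    (ξ η : ℕ → ℝ) (s t : ℝ) :
    HasDerivAt (fun t => ∏ k ∈ T, charFun (law r) (s * ξ k + t * η k))
      (∑ i ∈ T, (∏ k ∈ T.erase i, charFun (law r) (s * ξ k + t * η k)) *
        (η i * deriv (charFun (law r)) (s * ξ i + t * η i))) t := by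
  have := HasDerivAt.fun_finsetProd (u := T) (x := t)
    (f := fun k t => charFun (law r) (s * ξ k + t * η k))
    (f' := fun i => η i * deriv (charFun (law r)) (s * ξ i + t * η i)) (fun i _ => by
      have h1 : HasDerivAt (fun t : ℝ => s * ξ i + t * η i) (η i) t := by
        simpa using ((hasDerivAt_id t).mul_const (η i)).const_add (s * ξ i)
      have := (hr.hasDerivAt (s * ξ i + t * η i)).scomp t h1
      simpa [Function.comp_def] using this)
  simpa [smul_eq_mul] using this

theorem AdmissibleDensity.hasDerivAt_prod_deriv (hr : AdmissibleDensity r a) (T : Finset ℕ)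
    (ξ η : ℕ → ℝ) (s t : ℝ) :
    HasDerivAt (fun t => ∑ i ∈ T, (∏ k ∈ T.erase i, charFun (law r) (s * ξ k + t * η k)) *
        (η i * deriv (charFun (law r)) (s * ξ i + t * η i)))
      (∑ i ∈ T, ((∑ j ∈ T.erase i, (∏ k ∈ (T.erase i).erase j, charFun (law r) (s * ξ k + t * η k)) *
        (η j * deriv (charFun (law r)) (s * ξ j + t * η j))) *
          (η i * deriv (charFun (law r)) (s * ξ i + t * η i)) +
        (∏ k ∈ T.erase i, charFun (law r) (s * ξ k + t * η k)) *
          (η i * (η i * iteratedDeriv 2 (charFun (law r)) (s * ξ i + t * η i))))) t := by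
  refine HasDerivAt.fun_sum fun i _ => ?_
  refine (hr.hasDerivAt_prod (T.erase i) ξ η s t).mul ?_
  have h1 : HasDerivAt (fun t : ℝ => s * ξ i + t * η i) (η i) t := by
    simpa using ((hasDerivAt_id t).mul_const (η i)).const_add (s * ξ i)
  have := ((hr.hasDerivAt_deriv (s * ξ i + t * η i)).scomp t h1).const_mul (η i : ℂ)
  simpa [Function.comp_def] using this

/-- Two differentiations remove at most two factors, and the rest is at most `Q⁻³` with `Q = 1 + a /
2 * (s² + t²)`. The removed factors contribute `1 + s² + t²` in total: Cauchy–Schwarz for the terms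
with two first derivatives, `∑ η² = 1` for those with a second derivative. This is at most `(1 + 2 /
a) Q`, and the remaining powers of `Q` give a bound uniform in `t` and integrable in `s`. -/
theorem AdmissibleDensity.norm_second_deriv_le (hr : AdmissibleDensity r a) (hF : Frame S ξ η)
    (hsmall : ∀ k ∈ S, ξ k ^ 2 + η k ^ 2 ≤ 1 / 4) (s t : ℝ) :
    ‖∑ i ∈ S, ((∑ j ∈ S.erase i, (∏ k ∈ (S.erase i).erase j, charFun (law r) (s * ξ k + t * η k)) *
        (η j * deriv (charFun (law r)) (s * ξ j + t * η j))) *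
          (η i * deriv (charFun (law r)) (s * ξ i + t * η i)) +
        (∏ k ∈ S.erase i, charFun (law r) (s * ξ k + t * η k)) *
          (η i * (η i * iteratedDeriv 2 (charFun (law r)) (s * ξ i + t * η i))))‖ ≤
      (1 + 2 / a) / (1 + a / 2 * s ^ 2) := by
  have ha := hr.a_pos
  set G : ℝ := 1 / (1 + a / 2 * (s ^ 2 + t ^ 2)) ^ 3 with hG
  have hG0 : 0 ≤ G := by positivity
  set w : ℕ → ℝ := fun k => |η k| * |s * ξ k + t * η k| with hw
  have hw0 : ∀ k, 0 ≤ w k := fun k => by positivity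
  have hd : ∀ i, ‖(η i : ℂ) * deriv (charFun (law r)) (s * ξ i + t * η i)‖ ≤ w i := fun i => by
    rw [norm_mul, Complex.norm_real, Real.norm_eq_abs]
    exact mul_le_mul_of_nonneg_left (hr.norm_deriv_le _) (abs_nonneg _)
  have hA : ∀ i ∈ S, ‖∏ k ∈ S.erase i, charFun (law r) (s * ξ k + t * η k)‖ ≤ G := fun i hi => by
    refine hr.norm_prod_le hF hsmall s t (Finset.erase_subset _ _) ?_
    rw [Finset.sdiff_erase hi]
    simp
  have hB : ∀ i ∈ S, ∀ j ∈ S.erase i,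
      ‖∏ k ∈ (S.erase i).erase j, charFun (law r) (s * ξ k + t * η k)‖ ≤ G := fun i hi j hj => by
    refine hr.norm_prod_le hF hsmall s t
      ((Finset.erase_subset _ _).trans (Finset.erase_subset _ _)) ?_
    rw [Finset.card_sdiff_of_subset ((Finset.erase_subset _ _).trans (Finset.erase_subset _ _)),
      Finset.card_erase_of_mem hj, Finset.card_erase_of_mem hi]
    omega
  have hsumw : (∑ k ∈ S, w k) ^ 2 ≤ s ^ 2 + t ^ 2 := by
    have := Finset.sum_mul_sq_le_sq_mul_sq S (fun k => |η k|) (fun k => |s * ξ k + t * η k|)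
    simpa [sq_abs, hF.right, hF.sum_sq s t] using this
  have hterm : ∀ i ∈ S, ‖(∑ j ∈ S.erase i, (∏ k ∈ (S.erase i).erase j, charFun (law r) (s * ξ k + t * η k)) *
        (η j * deriv (charFun (law r)) (s * ξ j + t * η j))) *
          (η i * deriv (charFun (law r)) (s * ξ i + t * η i)) +
        (∏ k ∈ S.erase i, charFun (law r) (s * ξ k + t * η k)) *
          (η i * (η i * iteratedDeriv 2 (charFun (law r)) (s * ξ i + t * η i)))‖ ≤
      G * (∑ k ∈ S, w k) * w i + G * η i ^ 2 := by
    intro i hi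
    refine (norm_add_le _ _).trans (add_le_add ?_ ?_)
    · rw [norm_mul]
      refine mul_le_mul ?_ (hd i) (norm_nonneg _) (mul_nonneg hG0 (Finset.sum_nonneg fun k _ => hw0 k))
      refine (norm_sum_le _ _).trans ?_
      calc _ ≤ ∑ j ∈ S.erase i, G * w j := by
            refine Finset.sum_le_sum fun j hj => ?_
            rw [norm_mul]
            exact mul_le_mul (hB i hi j hj) (hd j) (norm_nonneg _) hG0
        _ ≤ ∑ j ∈ S, G * w j :=
            Finset.sum_le_sum_of_subset_of_nonneg (Finset.erase_subset _ _)
              fun j _ _ => mul_nonneg hG0 (hw0 j)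
        _ = _ := by rw [Finset.mul_sum]
    · rw [norm_mul, norm_mul, norm_mul, Complex.norm_real, Real.norm_eq_abs]
      refine mul_le_mul (hA i hi) ?_ (by positivity) hG0
      have h1 := hr.norm_deriv_two_le (s * ξ i + t * η i)
      calc |η i| * (|η i| * ‖iteratedDeriv 2 (charFun (law r)) (s * ξ i + t * η i)‖)
          ≤ |η i| * (|η i| * 1) := by gcongr
        _ = η i ^ 2 := by rw [mul_one, abs_mul_abs_self, sq]
  refine (norm_sum_le _ _).trans ((Finset.sum_le_sum hterm).trans ?_)
  rw [Finset.sum_add_distrib, ← Finset.mul_sum, ← Finset.mul_sum, hF.right]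
  have h1 : G * (∑ k ∈ S, w k) * ∑ k ∈ S, w k + G * 1 ≤ G * (1 + (s ^ 2 + t ^ 2)) := by
    nlinarith
  refine h1.trans ?_
  set Q : ℝ := 1 + a / 2 * (s ^ 2 + t ^ 2) with hQ
  have hQ1 : 1 ≤ Q := by
    have : 0 ≤ a / 2 * (s ^ 2 + t ^ 2) := by positivity
    linarith
  have hQs : 1 + a / 2 * s ^ 2 ≤ Q := by
    have : 0 ≤ a / 2 * t ^ 2 := by positivity
    rw [hQ]; linarith
  have h2 : 1 + (s ^ 2 + t ^ 2) ≤ (1 + 2 / a) * Q := by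
    have : (1 + 2 / a) * Q = 1 + (s ^ 2 + t ^ 2) + 2 / a + a / 2 * (s ^ 2 + t ^ 2) := by
      rw [hQ]; field_simp; ring
    rw [this]
    have h3 : 0 ≤ 2 / a := by positivity
    have h4 : 0 ≤ a / 2 * (s ^ 2 + t ^ 2) := by positivity
    linarith
  have hC : 0 ≤ 1 + 2 / a := by positivity
  rw [hG, one_div, inv_mul_le_iff₀ (by positivity)]
  rw [mul_div_assoc', le_div_iff₀ (by positivity)]
  calc (1 + (s ^ 2 + t ^ 2)) * (1 + a / 2 * s ^ 2) ≤ ((1 + 2 / a) * Q) * Q := by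
        refine mul_le_mul h2 hQs (by positivity) (by positivity)
    _ ≤ ((1 + 2 / a) * Q) * Q * Q := le_mul_of_one_le_right (by positivity) hQ1
    _ = _ := by ring

/-- A symmetric second difference is controlled by the second derivative. -/
theorem norm_second_difference_le {F F' F'' : ℝ → ℂ} {M : ℝ} (hF : ∀ t, HasDerivAt F (F' t) t)
    (hF' : ∀ t, HasDerivAt F' (F'' t) t) (hM : ∀ t, ‖F'' t‖ ≤ M) (t : ℝ) :
    ‖F t + F (-t) - 2 * F 0‖ ≤ 2 * M * t ^ 2 := by
  have hM0 : 0 ≤ M := (norm_nonneg _).trans (hM 0)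
  have h1 : ∀ x y, ‖F' y - F' x‖ ≤ M * |y - x| := fun x y =>
    Convex.norm_image_sub_le_of_norm_hasDerivWithin_le (s := Set.univ)
      (fun x _ => (hF' x).hasDerivWithinAt) (fun x _ => hM x) convex_univ (Set.mem_univ x)
      (Set.mem_univ y)
  -- The derivative of the symmetrized function is a difference of values of `F'`, so the mean value
  -- inequality is used twice.
  have hD : ∀ x, HasDerivAt (fun t => F t + F (-t)) (F' x - F' (-x)) x := fun x => by
    have h2 : HasDerivAt (fun t => F (-t)) (-F' (-x)) x := by
      have := (hF (-x)).scomp x (hasDerivAt_neg x)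
      simpa [Function.comp_def] using this
    exact ((hF x).add h2).congr_deriv (sub_eq_add_neg _ _).symm
  have h3 := Convex.norm_image_sub_le_of_norm_hasDerivWithin_le (s := Set.uIcc 0 t)
    (f := fun t => F t + F (-t)) (C := 2 * M * |t|)
    (fun x _ => (hD x).hasDerivWithinAt) (fun x hx => by
      refine (h1 (-x) x).trans ?_
      have hx' : |x| ≤ |t| := by
        have := Set.abs_sub_left_of_mem_uIcc hx
        simpa using this
      have : |x - -x| = 2 * |x| := by
        rw [sub_neg_eq_add, ← two_mul, abs_mul]; norm_num
      rw [this]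
      nlinarith) (convex_uIcc 0 t) Set.left_mem_uIcc Set.right_mem_uIcc
  simp only [neg_zero, sub_zero, Real.norm_eq_abs] at h3
  calc _ = ‖F t + F (-t) - (F 0 + F 0)‖ := by ring_nf
    _ ≤ 2 * M * |t| * |t| := h3
    _ = _ := by rw [mul_assoc, abs_mul_abs_self, sq]

/-- Uniform integrable bound for the weighted second difference. -/
theorem AdmissibleDensity.norm_secondDiff_le (hr : AdmissibleDensity r a) (hF : Frame S ξ η)
    (hsmall : ∀ k ∈ S, ξ k ^ 2 + η k ^ 2 ≤ 1 / 4) (s t : ℝ) :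
    ‖secondDiff r S ξ η s t‖ ≤
      4 * (1 + 2 / a) * (1 + a / 2 * s ^ 2)⁻¹ * (1 + t ^ 2)⁻¹ := by
  have ha := hr.a_pos
  set L : ℝ := (1 + a / 2 * s ^ 2)⁻¹ with hL
  have hL0 : 0 < L := by positivity
  have hC : 0 < 2 / a := by positivity
  -- At `t = 0` the quotient is `0` by the convention for division.
  rcases eq_or_ne t 0 with rfl | ht
  · simp only [secondDiff, Complex.ofReal_zero, ne_eq, OfNat.ofNat_ne_zero, not_false_eq_true,
      zero_pow, div_zero, norm_zero]
    positivity
  have ht2 : 0 < t ^ 2 := by positivity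
  have hb : ∀ τ, ‖jointChar r S ξ η s τ‖ ≤ L := fun τ => by
    refine (hr.norm_prod_le hF hsmall s τ subset_rfl (by simp)).trans ?_
    rw [hL, ← one_div]
    have h1 : 1 + a / 2 * s ^ 2 ≤ 1 + a / 2 * (s ^ 2 + τ ^ 2) := by
      have : 0 ≤ a / 2 * τ ^ 2 := by positivity
      linarith
    have h0 : 1 ≤ 1 + a / 2 * s ^ 2 := by
      have : 0 ≤ a / 2 * s ^ 2 := by positivity
      linarith
    refine one_div_le_one_div_of_le (by linarith) (h1.trans ?_)
    exact le_self_pow₀ (h0.trans h1) (by norm_num)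
  have hd := norm_second_difference_le (hr.hasDerivAt_prod S ξ η s)
    (hr.hasDerivAt_prod_deriv S ξ η s) (hr.norm_second_deriv_le hF hsmall s) t
  have h1 : ‖jointChar r S ξ η s t + jointChar r S ξ η s (-t) - 2 * jointChar r S ξ η s 0‖ ≤
      2 * (1 + 2 / a) * L * t ^ 2 := by
    refine hd.trans (le_of_eq ?_)
    rw [hL]; ring
  have h2 : ‖jointChar r S ξ η s t + jointChar r S ξ η s (-t) - 2 * jointChar r S ξ η s 0‖ ≤
      4 * L := by
    refine (norm_sub_le _ _).trans ?_
    have h3 := norm_add_le (jointChar r S ξ η s t) (jointChar r S ξ η s (-t))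
    rw [norm_mul, Complex.norm_ofNat]
    linarith [hb t, hb (-t), hb 0]
  have h3 : ‖secondDiff r S ξ η s t‖ =
      ‖jointChar r S ξ η s t + jointChar r S ξ η s (-t) - 2 * jointChar r S ξ η s 0‖ / (2 * t ^ 2) := by
    have : secondDiff r S ξ η s t =
        -((jointChar r S ξ η s t + jointChar r S ξ η s (-t) - 2 * jointChar r S ξ η s 0) /
          (2 * (t : ℂ) ^ 2)) := by
      unfold secondDiff
      have : (t : ℂ) ≠ 0 := by exact_mod_cast ht
      field_simp
      ring
    rw [this, norm_neg, norm_div, norm_mul, norm_pow, Complex.norm_real, Complex.norm_ofNat,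
      Real.norm_eq_abs, sq_abs]
  rw [h3, div_le_iff₀ (by positivity)]
  set N := ‖jointChar r S ξ η s t + jointChar r S ξ η s (-t) - 2 * jointChar r S ξ η s 0‖
  -- `h1`, effective for small `t`, controls `N`; the trivial bound `h2`, effective for large `t`,
  -- controls `N t²`.
  have h4 : N * (1 + t ^ 2) ≤ 8 * (1 + 2 / a) * L * t ^ 2 := by
    have : 0 ≤ 2 / a * L * t ^ 2 := by positivity
    nlinarith
  rw [show 4 * (1 + 2 / a) * L * (1 + t ^ 2)⁻¹ * (2 * t ^ 2) =
    8 * (1 + 2 / a) * L * t ^ 2 / (1 + t ^ 2) by ring, le_div_iff₀ (by positivity)]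
  exact h4

/-- Uniform central limit theorem for joint characteristic functions. -/
theorem AdmissibleDensity.exists_norm_jointChar_sub_le (hr : AdmissibleDensity r a) (s t : ℝ)
    {ε : ℝ} (hε : 0 < ε) :
    ∃ δ > 0, ∀ (S : Finset ℕ) (ξ η : ℕ → ℝ), Frame S ξ η →
      (∀ k ∈ S, ξ k ^ 2 + η k ^ 2 ≤ δ) →
      ‖jointChar r S ξ η s t - Complex.exp (-((s : ℂ) ^ 2 + (t : ℂ) ^ 2) / 2)‖ ≤ ε := by
  set R : ℝ := s ^ 2 + t ^ 2 + 1 with hR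
  have hR0 : 0 < R := by positivity
  have h1 := hr.isLittleO_gaussian.def (c := ε / R) (by positivity)
  obtain ⟨d, hd, h2⟩ := Metric.eventually_nhds_iff.1 h1
  -- By Cauchy–Schwarz this puts every argument `s ξ_k + t η_k` within `d` of `0`. The Taylor errors
  -- then sum to at most `ε / R * (s² + t²)`.
  refine ⟨d ^ 2 / (2 * R), by positivity, fun S ξ η hF hsmall => ?_⟩
  have hexp : Complex.exp (-((s : ℂ) ^ 2 + (t : ℂ) ^ 2) / 2) =
      ∏ k ∈ S, Complex.exp (-((s * ξ k + t * η k : ℝ) : ℂ) ^ 2 / 2) := by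
    rw [← Complex.exp_sum]
    congr 1
    rw [← Finset.sum_div, Finset.sum_neg_distrib]
    congr 2
    have := hF.sum_sq s t
    rw [← Complex.ofReal_pow, ← Complex.ofReal_pow, ← Complex.ofReal_add, ← this]
    push_cast
    rfl
  rw [hexp, jointChar]
  refine (norm_prod_sub_prod_le_sum S (fun k _ => hr.norm_le_one _) fun k _ => ?_).trans ?_
  · rw [← Complex.ofReal_pow, Complex.norm_exp]
    rw [show (-((((s * ξ k + t * η k) ^ 2 : ℝ)) : ℂ) / 2) =
      ((-(s * ξ k + t * η k) ^ 2 / 2 : ℝ) : ℂ) by push_cast; ring, Complex.ofReal_re]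
    refine Real.exp_le_one_iff.2 ?_
    have := sq_nonneg (s * ξ k + t * η k)
    linarith
  · calc _ ≤ ∑ k ∈ S, ε / R * (s * ξ k + t * η k) ^ 2 := by
          refine Finset.sum_le_sum fun k hk => ?_
          have h3 : dist (s * ξ k + t * η k) 0 < d := by
            rw [dist_zero_right, Real.norm_eq_abs]
            refine abs_lt_of_sq_lt_sq ?_ hd.le
            have h4 := sq_add_mul_le s t (ξ k) (η k)
            have h5 := hsmall k hk
            rw [le_div_iff₀ (by positivity)] at h5
            have h6 : 0 ≤ ξ k ^ 2 + η k ^ 2 := by positivity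
            have h7 : 0 < d ^ 2 := by positivity
            nlinarith
          have := h2 h3
          simpa using this
      _ = ε / R * (s ^ 2 + t ^ 2) := by rw [← Finset.mul_sum, hF.sum_sq]
      _ ≤ ε := by
          rw [div_mul_eq_mul_div, div_le_iff₀ hR0]
          nlinarith

end Frame

end Density

end SO2Ensemble

/-! ### Absolute moments by Fourier integrals and the limit of the normalized intensity -/

namespace SO2Ensemble

/-- The constant in `|y| = absConst⁻¹ ∫ (1 - cos (t y)) / t²`. -/
noncomputable def absConst : ℝ := ∫ t : ℝ, (1 - Real.cos t) / t ^ 2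

theorem one_sub_cos_div_sq_nonneg (y t : ℝ) : 0 ≤ (1 - Real.cos (t * y)) / t ^ 2 :=
  div_nonneg (by linarith [Real.cos_le_one (t * y)]) (sq_nonneg t)

theorem integrable_one_sub_cos_div_sq : Integrable fun t : ℝ => (1 - Real.cos t) / t ^ 2 := by
  refine (integrable_inv_one_add_sq.const_mul 4).mono'
    (by measurability : Measurable fun t : ℝ => (1 - Real.cos t) / t ^ 2).aestronglyMeasurable (ae_of_all _ fun t => ?_)
  rw [Real.norm_of_nonneg (by simpa using one_sub_cos_div_sq_nonneg 1 t)]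
  rcases eq_or_ne t 0 with rfl | ht
  · simp
  have ht2 : 0 < t ^ 2 := by positivity
  rw [div_le_iff₀ ht2, mul_assoc, inv_mul_eq_div, mul_div_assoc', le_div_iff₀ (by positivity)]
  have h1 := Real.one_sub_sq_div_two_le_cos (x := t)
  have h2 := Real.neg_one_le_cos t
  nlinarith

theorem absConst_pos : 0 < absConst := by
  unfold absConst
  rw [integral_pos_iff_support_of_nonneg (fun t => by simpa using one_sub_cos_div_sq_nonneg 1 t)
    integrable_one_sub_cos_div_sq]
  have hsub : Set.Ioo 0 1 ⊆ Function.support fun t : ℝ => (1 - Real.cos t) / t ^ 2 := by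
    rintro t ⟨h0, h1⟩
    have hc : Real.cos t < 1 := by
      rw [← Real.cos_zero]
      exact Real.cos_lt_cos_of_nonneg_of_le_pi le_rfl (by linarith [Real.pi_gt_three]) h0
    have : 0 < (1 - Real.cos t) / t ^ 2 := div_pos (by linarith) (by positivity)
    exact this.ne'
  exact lt_of_lt_of_le (by simp) (measure_mono hsub)

theorem one_sub_cos_mul_div_sq (y t : ℝ) : (1 - Real.cos (t * y)) / t ^ 2 =
    y ^ 2 * ((1 - Real.cos (t * y)) / (t * y) ^ 2) := by
  rcases eq_or_ne y 0 with rfl | hy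
  · simp
  rcases eq_or_ne t 0 with rfl | ht
  · simp
  field_simp

theorem integrable_one_sub_cos_mul_div_sq (y : ℝ) :
    Integrable fun t : ℝ => (1 - Real.cos (t * y)) / t ^ 2 := by
  rcases eq_or_ne y 0 with rfl | hy
  · simp
  simp_rw [one_sub_cos_mul_div_sq y]
  exact (integrable_one_sub_cos_div_sq.comp_mul_right' hy).const_mul (y ^ 2)

theorem integral_one_sub_cos_mul_div_sq (y : ℝ) :
    ∫ t : ℝ, (1 - Real.cos (t * y)) / t ^ 2 = absConst * |y| := by
  rcases eq_or_ne y 0 with rfl | hy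
  · simp
  simp_rw [one_sub_cos_mul_div_sq y]
  rw [integral_const_mul, Measure.integral_comp_mul_right (fun t => (1 - Real.cos t) / t ^ 2),
    ← absConst, smul_eq_mul, abs_inv, ← sq_abs]
  have : |y| ≠ 0 := abs_ne_zero.2 hy
  field_simp

section General

variable {Ω : Type*} [MeasurableSpace Ω] {P : Measure Ω} [IsProbabilityMeasure P]

/-- The first absolute moment of `Y` twisted by `X` in terms of joint characteristic functions. -/
theorem absConst_mul_integral_abs_mul_cexp {X Y : Ω → ℝ} (hX : Measurable X) (hY : Measurable Y)
    (hYi : Integrable Y P) :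
    (absConst : ℂ) * ∫ ω, ((|Y ω| : ℝ) : ℂ) * Complex.exp (X ω * Complex.I) ∂P =
      ∫ t : ℝ, ((∫ ω, Complex.exp (X ω * Complex.I) ∂P) -
        ((∫ ω, Complex.exp ((X ω + t * Y ω : ℝ) * Complex.I) ∂P) +
          (∫ ω, Complex.exp ((X ω + (-t) * Y ω : ℝ) * Complex.I) ∂P)) / 2) / (t : ℂ) ^ 2 := by
  -- The norm of the kernel integrates in `t` to `absConst * |Y|`, so integrability of `Y` justifies
  -- Fubini. Expanding the cosine into exponentials yields the symmetric difference.
  set K : Ω → ℝ → ℂ := fun ω t =>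
    (((1 - Real.cos (t * Y ω)) / t ^ 2 : ℝ) : ℂ) * Complex.exp (X ω * Complex.I) with hK
  have hKm : Measurable (Function.uncurry K) := by
    simp only [hK, Function.uncurry_def]
    fun_prop
  have hnorm : ∀ ω t, ‖K ω t‖ = (1 - Real.cos (t * Y ω)) / t ^ 2 := fun ω t => by
    rw [hK, norm_mul, Complex.norm_exp_ofReal_mul_I, mul_one, Complex.norm_real,
      Real.norm_of_nonneg (one_sub_cos_div_sq_nonneg _ _)]
  have hKi : Integrable (Function.uncurry K) (P.prod volume) := by
    rw [integrable_prod_iff hKm.aestronglyMeasurable]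
    constructor
    · refine ae_of_all _ fun ω => ?_
      exact ((integrable_one_sub_cos_mul_div_sq (Y ω)).ofReal (𝕜 := ℂ)).mul_const
        (Complex.exp (X ω * Complex.I))
    · simp only [Function.uncurry_apply_pair, hnorm, integral_one_sub_cos_mul_div_sq]
      exact hYi.abs.const_mul _
  have h1 : (absConst : ℂ) * ∫ ω, ((|Y ω| : ℝ) : ℂ) * Complex.exp (X ω * Complex.I) ∂P =
      ∫ ω, (∫ t : ℝ, K ω t) ∂P := by
    rw [← integral_const_mul]
    refine integral_congr_ae (ae_of_all _ fun ω => ?_)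
    simp only [hK]
    rw [integral_mul_const, integral_complex_ofReal, integral_one_sub_cos_mul_div_sq]
    push_cast
    ring
  rw [h1, integral_integral_swap hKi]
  refine integral_congr_ae (ae_of_all _ fun t => ?_)
  have hint : ∀ Z : Ω → ℝ, Measurable Z → Integrable (fun ω => Complex.exp (Z ω * Complex.I)) P :=
    fun Z hZ => by
      refine (integrable_const (1 : ℝ)).mono' (by fun_prop) (ae_of_all _ fun ω => ?_)
      rw [Complex.norm_exp_ofReal_mul_I]
  simp only
  have hp := hint (fun ω => X ω + t * Y ω) (by fun_prop)
  have hm := hint (fun ω => X ω + (-t) * Y ω) (by fun_prop)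
  rw [← integral_add hp hm, ← integral_div, ← integral_sub (f := fun ω => Complex.exp (X ω * Complex.I)) (hint X hX)
      (g := fun ω => (Complex.exp ((X ω + t * Y ω : ℝ) * Complex.I) +
        Complex.exp ((X ω + (-t) * Y ω : ℝ) * Complex.I)) / 2) ((hp.add hm).div_const 2),
    ← integral_div]
  refine integral_congr_ae (ae_of_all _ fun ω => ?_)
  simp only [hK, Complex.ofReal_div, Complex.ofReal_sub, Complex.ofReal_one, Complex.ofReal_cos,
    Complex.cos, Complex.ofReal_pow, Complex.ofReal_add, Complex.ofReal_mul, Complex.ofReal_neg,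
    add_mul, Complex.exp_add, neg_mul]
  ring

end General

theorem integral_abs_gaussianReal :
    ∫ y, |y| ∂gaussianReal 0 1 = Real.sqrt (2 / Real.pi) := by
  rw [integral_gaussianReal_eq_integral_smul one_ne_zero]
  have h1 : ∀ x : ℝ, gaussianPDFReal 0 1 x • |x| =
      (Real.sqrt (2 * Real.pi))⁻¹ * (|x| ^ (1:ℝ) * Real.exp (-(1 / 2) * |x| ^ (2:ℝ))) := fun x => by
    rw [gaussianPDFReal, smul_eq_mul, Real.rpow_one, Real.rpow_two, sq_abs]
    simp only [NNReal.coe_one, mul_one, sub_zero]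
    rw [show -x ^ 2 / 2 = -(1 / 2) * x ^ 2 by ring]
    ring
  simp_rw [h1]
  rw [integral_const_mul, integral_comp_abs (f := fun x => x ^ (1:ℝ) * Real.exp (-(1 / 2) * x ^ (2:ℝ))),
    integral_rpow_mul_exp_neg_mul_rpow (by norm_num) (by norm_num) (by norm_num)]
  norm_num
  have hpi : 0 < Real.sqrt Real.pi := Real.sqrt_pos.2 Real.pi_pos
  field_simp
  norm_num

/-- The moment identity for `X = 0` and a standard Gaussian `Y`. This makes the numerical value of
`absConst` unnecessary, since it cancels in the limit. -/
theorem integral_one_sub_exp_div_sq :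
    ∫ t : ℝ, (1 - Complex.exp (-(t : ℂ) ^ 2 / 2)) / (t : ℂ) ^ 2 =
      (absConst : ℂ) * (Real.sqrt (2 / Real.pi) : ℝ) := by
  have h := absConst_mul_integral_abs_mul_cexp (P := gaussianReal 0 1) (X := fun _ => 0) (Y := id)
    measurable_const measurable_id (by
      have := (memLp_id_gaussianReal (μ := 0) (v := 1) 1)
      exact memLp_one_iff_integrable.1 (by exact_mod_cast this))
  have h2 : ∀ t : ℝ, ∫ y, Complex.exp ((0 + t * id y : ℝ) * Complex.I) ∂gaussianReal 0 1 =
      Complex.exp (-(t : ℂ) ^ 2 / 2) := fun t => by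
    have := charFun_gaussianReal (μ := 0) (v := 1) t
    rw [charFun_apply_real] at this
    simp only [zero_add, id, Complex.ofReal_mul]
    rw [this]
    simp [neg_div]
  simp only [h2] at h
  rw [← integral_abs_gaussianReal]
  simp only [Complex.ofReal_zero, zero_mul, Complex.exp_zero, mul_one] at h
  rw [integral_complex_ofReal] at h
  refine Eq.trans ?_ h.symm
  refine integral_congr_ae (ae_of_all _ fun t => ?_)
  simp

section Limit

variable {r : ℝ → ℝ} {a : ℝ}

theorem AdmissibleDensity.continuous_jointChar (hr : AdmissibleDensity r a) (S : Finset ℕ)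
    (ξ η : ℕ → ℝ) : Continuous fun q : ℝ × ℝ => jointChar r S ξ η q.1 q.2 := by
  unfold jointChar
  refine continuous_finsetProd _ fun k _ => ?_
  exact hr.contDiff.continuous.comp (by fun_prop)

theorem AdmissibleDensity.measurable_jointChar_comp (hr : AdmissibleDensity r a) (S : Finset ℕ)
    (ξ η : ℕ → ℝ) {f : ℝ × ℝ → ℝ × ℝ} (hf : Measurable f) :
    Measurable fun q : ℝ × ℝ => jointChar r S ξ η (f q).1 (f q).2 :=
  (hr.continuous_jointChar S ξ η).measurable.comp hf

theorem AdmissibleDensity.measurable_secondDiff (hr : AdmissibleDensity r a) (S : Finset ℕ)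
    (ξ η : ℕ → ℝ) : Measurable fun q : ℝ × ℝ => secondDiff r S ξ η q.1 q.2 := by
  have h1 := hr.measurable_jointChar_comp S ξ η (f := fun q => (q.1, q.2)) (by fun_prop)
  have h2 := hr.measurable_jointChar_comp S ξ η (f := fun q => (q.1, 0)) (by fun_prop)
  have h3 := hr.measurable_jointChar_comp S ξ η (f := fun q => (q.1, -q.2)) (by fun_prop)
  have h4 : Measurable fun q : ℝ × ℝ => (q.2 : ℂ) ^ 2 := by fun_prop
  unfold secondDiff
  dsimp only at h1 h2 h3
  generalize jointChar r S ξ η = J at *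
  fun_prop

theorem AdmissibleDensity.stronglyMeasurable_integral_secondDiff (hr : AdmissibleDensity r a)
    (S : Finset ℕ) (ξ η : ℕ → ℝ) :
    StronglyMeasurable fun s : ℝ => ∫ t, secondDiff r S ξ η s t :=
  StronglyMeasurable.integral_prod_right (f := secondDiff r S ξ η)
    (hr.measurable_secondDiff S ξ η).stronglyMeasurable

theorem AdmissibleDensity.norm_integral_secondDiff_le (hr : AdmissibleDensity r a)
    {S : Finset ℕ} {ξ η : ℕ → ℝ} (hF : Frame S ξ η)
    (hsmall : ∀ k ∈ S, ξ k ^ 2 + η k ^ 2 ≤ 1 / 4) (s : ℝ) :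
    ‖∫ t, secondDiff r S ξ η s t‖ ≤ 4 * (1 + 2 / a) * (1 + a / 2 * s ^ 2)⁻¹ * Real.pi := by
  rw [← integral_univ_inv_one_add_sq, ← integral_const_mul]
  exact norm_integral_le_of_norm_le (integrable_inv_one_add_sq.const_mul _)
    (ae_of_all _ fun t => hr.norm_secondDiff_le hF hsmall s t)

theorem AdmissibleDensity.integrable_bound (hr : AdmissibleDensity r a) :
    Integrable fun w : ℝ =>
      4 * (1 + 2 / a) * (1 + a / 2 * (-2 * Real.pi * w) ^ 2)⁻¹ * Real.pi := by
  have ha := hr.a_pos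
  set l : ℝ := Real.sqrt (a / 2) * (2 * Real.pi) with hl
  have hl0 : l ≠ 0 := by
    have := Real.pi_pos
    have : 0 < Real.sqrt (a / 2) := Real.sqrt_pos.2 (by positivity)
    positivity
  have h1 : ∀ w : ℝ, a / 2 * (-2 * Real.pi * w) ^ 2 = (w * l) ^ 2 := fun w => by
    rw [hl, mul_pow w, mul_pow (Real.sqrt _), Real.sq_sqrt (by positivity)]
    ring
  simp_rw [h1]
  exact ((integrable_inv_one_add_sq.comp_mul_right' hl0).const_mul _).mul_const _

/-- The Fourier expression for the normalized intensity. -/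
noncomputable def fourierIntensity (r : ℝ → ℝ) (S : Finset ℕ) (ξ η : ℕ → ℝ) : ℂ :=
  (absConst : ℂ)⁻¹ * ∫ w : ℝ, ∫ t : ℝ, secondDiff r S ξ η (-2 * Real.pi * w) t

theorem AdmissibleDensity.exists_norm_fourierIntensity_le (hr : AdmissibleDensity r a) :
    ∃ C : ℝ, ∀ (S : Finset ℕ) (ξ η : ℕ → ℝ), Frame S ξ η →
      (∀ k ∈ S, ξ k ^ 2 + η k ^ 2 ≤ 1 / 4) → ‖fourierIntensity r S ξ η‖ ≤ C := by
  refine ⟨absConst⁻¹ * ∫ w : ℝ,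
      4 * (1 + 2 / a) * (1 + a / 2 * (-2 * Real.pi * w) ^ 2)⁻¹ * Real.pi, ?_⟩
  intro S ξ η hF hsmall
  rw [fourierIntensity, norm_mul, norm_inv, Complex.norm_real,
    Real.norm_of_nonneg absConst_pos.le]
  refine mul_le_mul_of_nonneg_left ?_ (inv_nonneg.2 absConst_pos.le)
  exact norm_integral_le_of_norm_le hr.integrable_bound
    (ae_of_all _ fun w => hr.norm_integral_secondDiff_le hF hsmall _)

/-- Dominated convergence, first in `t` and then in the frequency. The Gaussian limit of the second
difference factors into a function of `s` and one of `t`. The result is the Gaussian density at `0`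
times the Gaussian first absolute moment, `(2π)^(-1/2) · √(2/π) = 1/π`. -/
theorem AdmissibleDensity.tendsto_fourierIntensity (hr : AdmissibleDensity r a)
    {S : ℕ → Finset ℕ} {ξ η : ℕ → ℕ → ℝ} (hF : ∀ᶠ n in atTop, Frame (S n) (ξ n) (η n))
    (hsmall : ∀ δ > 0, ∀ᶠ n in atTop, ∀ k ∈ S n, ξ n k ^ 2 + η n k ^ 2 ≤ δ) :
    Tendsto (fun n => fourierIntensity r (S n) (ξ n) (η n)) atTop (𝓝 (1 / Real.pi : ℂ)) := by
  have hj : ∀ s t : ℝ, Tendsto (fun n => jointChar r (S n) (ξ n) (η n) s t) atTop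
      (𝓝 (Complex.exp (-((s : ℂ) ^ 2 + (t : ℂ) ^ 2) / 2))) := by
    intro s t
    rw [Metric.tendsto_nhds]
    intro ε hε
    obtain ⟨δ, hδ, h⟩ := hr.exists_norm_jointChar_sub_le s t (half_pos hε)
    filter_upwards [hF, hsmall δ hδ] with n h1 h2
    rw [dist_eq_norm]
    exact (h _ _ _ h1 h2).trans_lt (half_lt_self hε)
  set ψ : ℝ → ℂ := fun s => Complex.exp (-(s : ℂ) ^ 2 / 2) * ((absConst : ℂ) * (Real.sqrt (2 / Real.pi) : ℝ))
    with hψ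
  have hin : ∀ s : ℝ, Tendsto (fun n => ∫ t, secondDiff r (S n) (ξ n) (η n) s t) atTop
      (𝓝 (ψ s)) := by
    intro s
    have hlim : ψ s = ∫ t : ℝ, Complex.exp (-(s : ℂ) ^ 2 / 2) *
        ((1 - Complex.exp (-(t : ℂ) ^ 2 / 2)) / (t : ℂ) ^ 2) := by
      rw [integral_const_mul, integral_one_sub_exp_div_sq]
    rw [hlim]
    refine tendsto_integral_filter_of_dominated_convergence
      (fun t => 4 * (1 + 2 / a) * (1 + a / 2 * s ^ 2)⁻¹ * (1 + t ^ 2)⁻¹) ?_ ?_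
      (integrable_inv_one_add_sq.const_mul _) ?_
    · exact Eventually.of_forall fun n => ((hr.measurable_secondDiff (S n) (ξ n) (η n)).comp
        (measurable_const.prodMk measurable_id)).aestronglyMeasurable
    · filter_upwards [hF, hsmall (1 / 4) (by norm_num)] with n h1 h2
      exact ae_of_all _ fun t => hr.norm_secondDiff_le h1 h2 s t
    · refine ae_of_all _ fun t => ?_
      have h1 := (((hj s 0).sub (((hj s t).add (hj s (-t))).div_const 2))).div_const ((t : ℂ) ^ 2)
      have h2 : Complex.exp (-((s : ℂ) ^ 2 + (t : ℂ) ^ 2) / 2) =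
          Complex.exp (-(s : ℂ) ^ 2 / 2) * Complex.exp (-(t : ℂ) ^ 2 / 2) := by
        rw [← Complex.exp_add]; ring_nf
      have h3 : Complex.exp (-(s : ℂ) ^ 2 / 2) * ((1 - Complex.exp (-(t : ℂ) ^ 2 / 2)) / (t : ℂ) ^ 2) =
          (Complex.exp (-((s : ℂ) ^ 2 + ((0 : ℝ) : ℂ) ^ 2) / 2) -
            (Complex.exp (-((s : ℂ) ^ 2 + (t : ℂ) ^ 2) / 2) +
              Complex.exp (-((s : ℂ) ^ 2 + ((-t : ℝ) : ℂ) ^ 2) / 2)) / 2) / (t : ℂ) ^ 2 := by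
        simp only [Complex.ofReal_neg, Complex.ofReal_zero, neg_sq, h2, ne_eq, OfNat.ofNat_ne_zero,
          not_false_eq_true, zero_pow, add_zero]
        ring
      rw [h3]
      exact h1
  have hout : Tendsto (fun n => ∫ w : ℝ, ∫ t : ℝ,
      secondDiff r (S n) (ξ n) (η n) (-2 * Real.pi * w) t) atTop
      (𝓝 (∫ w : ℝ, ψ (-2 * Real.pi * w))) := by
    refine tendsto_integral_filter_of_dominated_convergence _ ?_ ?_ hr.integrable_bound ?_
    · exact Eventually.of_forall fun n =>
        ((hr.stronglyMeasurable_integral_secondDiff (S n) (ξ n) (η n)).comp_measurable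
          (by fun_prop)).aestronglyMeasurable
    · filter_upwards [hF, hsmall (1 / 4) (by norm_num)] with n h1 h2
      exact ae_of_all _ fun w => hr.norm_integral_secondDiff_le h1 h2 _
    · exact ae_of_all _ fun w => hin _
  have hval : (absConst : ℂ)⁻¹ * ∫ w : ℝ, ψ (-2 * Real.pi * w) = 1 / Real.pi := by
    have h1 : ∀ w : ℝ, ψ (-2 * Real.pi * w) =
        ((Real.exp (-(2 * Real.pi ^ 2) * w ^ 2) * (absConst * Real.sqrt (2 / Real.pi)) : ℝ) : ℂ) := by
      intro w
      simp only [hψ]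
      push_cast
      ring_nf
    simp_rw [h1]
    rw [integral_complex_ofReal, integral_mul_const, integral_gaussian]
    have hpi := Real.pi_pos
    have hs : Real.sqrt (Real.pi / (2 * Real.pi ^ 2)) * Real.sqrt (2 / Real.pi) = 1 / Real.pi := by
      rw [← Real.sqrt_mul (by positivity)]
      rw [show Real.pi / (2 * Real.pi ^ 2) * (2 / Real.pi) = (1 / Real.pi) ^ 2 by field_simp]
      exact Real.sqrt_sq (by positivity)
    have hc := absConst_pos.ne'
    rw [show Real.sqrt (Real.pi / (2 * Real.pi ^ 2)) * (absConst * Real.sqrt (2 / Real.pi)) =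
      absConst * (1 / Real.pi) by rw [← hs]; ring]
    push_cast
    have hc' : (absConst : ℂ) ≠ 0 := by exact_mod_cast hc
    field_simp
  rw [← hval]
  exact hout.const_mul _

end Limit

end SO2Ensemble

/-! ### Fourier inversion and weighted densities -/

namespace SO2Ensemble

open scoped FourierTransform

theorem fourier_law {r : ℝ → ℝ} (hm : Measurable r) (hr : ∀ t, 0 ≤ r t) (w : ℝ) :
    𝓕 (fun t => (r t : ℂ)) w = charFun (law r) (-2 * Real.pi * w) := by
  rw [Real.fourier_real_eq_integral_exp_smul, charFun_apply_real, law,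
    integral_withDensity_eq_integral_toReal_smul hm.ennreal_ofReal (by simp)]
  refine integral_congr_ae (ae_of_all _ fun t => ?_)
  simp only [ENNReal.toReal_ofReal (hr t), Complex.real_smul, smul_eq_mul]
  rw [mul_comm]
  congr 2
  push_cast
  ring

section Density

variable {r : ℝ → ℝ} {a : ℝ}

theorem AdmissibleDensity.integrable_charFun (hr : AdmissibleDensity r a) :
    Integrable fun w : ℝ => charFun (law r) (-2 * Real.pi * w) := by
  have ha := hr.a_pos
  refine (hr.integrable_bound).mono' ?_ (ae_of_all _ fun w => ?_)
  · exact (hr.contDiff.continuous.comp (by fun_prop)).aestronglyMeasurable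
  refine (hr.bound _).trans ?_
  set q := (-2 * Real.pi * w) ^ 2 with hq
  have hq0 : 0 ≤ q := by positivity
  have h1 : 1 + a / 2 * q ≤ (1 + a * q) ^ 3 := by
    have : 0 ≤ a * q := by positivity
    refine le_trans (by linarith) (le_self_pow₀ (by linarith : 1 ≤ 1 + a * q) (by norm_num))
  have h2 : 1 / (1 + a * q) ^ 3 ≤ (1 + a / 2 * q)⁻¹ := by
    rw [← one_div]
    exact one_div_le_one_div_of_le (by positivity) h1
  refine h2.trans ?_
  have h3 : 0 < (1 + a / 2 * q)⁻¹ := by positivity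
  have h4 : 0 < 2 / a := by positivity
  have h5 := Real.pi_gt_three
  have h6 : 1 ≤ 4 * (1 + 2 / a) * Real.pi := by nlinarith
  nlinarith

theorem AdmissibleDensity.integrable (hr : AdmissibleDensity r a) : Integrable r := by
  have h := hr.prob
  have h1 : ∫⁻ t, ENNReal.ofReal (r t) = 1 := by
    have := h.measure_univ
    rwa [law, withDensity_apply _ MeasurableSet.univ, Measure.restrict_univ] at this
  refine ⟨hr.cont.aestronglyMeasurable, ?_⟩
  rw [hasFiniteIntegral_iff_ofReal (ae_of_all _ hr.nonneg), h1]
  exact ENNReal.one_lt_top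

/-- Fourier inversion bounds the continuous density `r` by the `L¹` norm of its integrable
transform. -/
theorem AdmissibleDensity.exists_bound (hr : AdmissibleDensity r a) :
    ∃ M, 0 ≤ M ∧ ∀ t, r t ≤ M := by
  have hF : 𝓕 (fun t => (r t : ℂ)) = fun w => charFun (law r) (-2 * Real.pi * w) :=
    funext fun w => fourier_law hr.cont.measurable hr.nonneg w
  have hinv := Continuous.fourierInv_fourier_eq (f := fun t => (r t : ℂ))
    (Complex.continuous_ofReal.comp hr.cont) hr.integrable.ofReal
    (by rw [hF]; exact hr.integrable_charFun)
  refine ⟨∫ w : ℝ, ‖charFun (law r) (-2 * Real.pi * w)‖,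
    integral_nonneg fun _ => norm_nonneg _, fun t => ?_⟩
  have h1 := congrFun hinv t
  rw [Real.fourierInv_eq', hF] at h1
  have h2 : r t ≤ ‖(r t : ℂ)‖ := by
    rw [Complex.norm_real]; exact le_abs_self _
  refine h2.trans ?_
  rw [← h1]
  refine (norm_integral_le_integral_norm _).trans (le_of_eq ?_)
  refine integral_congr_ae (ae_of_all _ fun w => ?_)
  simp only [norm_smul, Complex.norm_exp_ofReal_mul_I, one_mul]

end Density

/-- Fourier inversion at the origin. -/
theorem apply_zero_eq_integral_fourier {W : ℝ → ℝ} (hc : Continuous W) (hi : Integrable W)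
    {ψ : ℝ → ℂ} (hψ : ∀ w, 𝓕 (fun u => (W u : ℂ)) w = ψ w) (hψi : Integrable ψ) :
    (W 0 : ℂ) = ∫ w, ψ w := by
  have hF : 𝓕 (fun u => (W u : ℂ)) = ψ := funext hψ
  have hinv := Continuous.fourierInv_fourier_eq (f := fun u => (W u : ℂ))
    (Complex.continuous_ofReal.comp hc) hi.ofReal (by rwa [hF])
  have h1 := congrFun hinv 0
  rw [Real.fourierInv_eq', hF] at h1
  rw [← h1]
  simp

section Weighted

/-- The density at `u` of the law of `c₀ + X` weighted by `|β c₀ + Y|`. -/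
noncomputable def weightedDensity {Ω : Type*} [MeasurableSpace Ω] (P : Measure Ω) (r : ℝ → ℝ)
    (X Y : Ω → ℝ) (β u : ℝ) : ℝ :=
  ∫ ω, r (u - X ω) * |Y ω + β * (u - X ω)| ∂P

theorem weightedDensity_nonneg {Ω : Type*} [MeasurableSpace Ω] {P : Measure Ω} {r : ℝ → ℝ}
    {a : ℝ} (hr : AdmissibleDensity r a) {X Y : Ω → ℝ} (β u : ℝ) :
    0 ≤ weightedDensity P r X Y β u :=
  integral_nonneg fun _ => mul_nonneg (hr.nonneg _) (abs_nonneg _)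

variable {Ω : Type*} [MeasurableSpace Ω] {P : Measure Ω} [IsProbabilityMeasure P]
  {c : ℕ → Ω → ℝ} {r : ℝ → ℝ} {a : ℝ}

variable {X Y : Ω → ℝ}

theorem integrable_weightedDensity_integrand (hr : AdmissibleDensity r a) (hX : Integrable X P)
    (hY : Integrable Y P) (β u : ℝ) :
    Integrable (fun ω => r (u - X ω) * |Y ω + β * (u - X ω)|) P := by
  obtain ⟨M, hM0, hM⟩ := hr.exists_bound
  have h1 : Integrable (fun ω => |Y ω + β * (u - X ω)|) P :=
    (hY.add (((integrable_const u).sub hX).const_mul β)).abs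
  refine h1.bdd_mul (c := M) ?_ (ae_of_all _ fun ω => ?_)
  · exact hr.cont.comp_aestronglyMeasurable (aestronglyMeasurable_const.sub hX.1)
  · rw [Real.norm_of_nonneg (hr.nonneg _)]
    exact hM _

/-- Continuity is what permits Fourier inversion at the single point `0`. -/
theorem continuous_weightedDensity (hr : AdmissibleDensity r a) (hX : Integrable X P)
    (hY : Integrable Y P) (β : ℝ) : Continuous (weightedDensity P r X Y β) := by
  obtain ⟨M, hM0, hM⟩ := hr.exists_bound
  refine continuous_iff_continuousAt.2 fun u₀ => ?_
  refine continuousAt_of_dominated (bound := fun ω => M * (|Y ω| + |β| * (|u₀| + 1 + |X ω|))) ?_ ?_ ?_ ?_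
  · exact Eventually.of_forall fun u => (integrable_weightedDensity_integrand hr hX hY β u).1
  · filter_upwards [Metric.ball_mem_nhds u₀ one_pos] with u hu
    refine ae_of_all _ fun ω => ?_
    rw [norm_mul, Real.norm_of_nonneg (hr.nonneg _), Real.norm_eq_abs, abs_abs]
    refine mul_le_mul (hM _) ?_ (abs_nonneg _) hM0
    refine (abs_add_le _ _).trans ?_
    rw [abs_mul]
    have h1 : |u - X ω| ≤ |u₀| + 1 + |X ω| := by
      have h2 : |u - u₀| < 1 := hu
      have h3 := abs_sub u (X ω)
      have h4 := abs_sub_abs_le_abs_sub u u₀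
      linarith
    have := mul_le_mul_of_nonneg_left h1 (abs_nonneg β)
    linarith
  · exact ((hY.abs.add (((integrable_const (|u₀| + 1)).add hX.abs).const_mul |β|)).const_mul M)
  · refine ae_of_all _ fun ω => Continuous.continuousAt ?_
    have := hr.cont
    fun_prop

variable {n : ℕ} {x y : (ℕ → ℝ) → ℝ}

/-- Given the tail, `c 0 + x` has density `u ↦ r (u - x)`, and `c 0` equals `u - x` there.
Integrating out `c 0`, translating and exchanging the integrals gives the weighted density. -/
theorem IsEnsemble.map_withDensity_eq (hc : IsEnsemble P c r) (hr : AdmissibleDensity r a)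
    (hx : Measurable x) (hy : Measurable y)
    (hX : Integrable (fun ω => x (tail n fun k => c k ω)) P)
    (hY : Integrable (fun ω => y (tail n fun k => c k ω)) P) (β : ℝ) :
    (P.withDensity fun ω => ENNReal.ofReal |y (tail n fun k => c k ω) + β * c 0 ω|).map
        (fun ω => c 0 ω + x (tail n fun k => c k ω)) =
      volume.withDensity fun u => ENNReal.ofReal (weightedDensity P r
        (fun ω => x (tail n fun k => c k ω)) (fun ω => y (tail n fun k => c k ω)) β u) := by
  have hT := hc.measurable_tail n
  have h0 := hc.meas 0
  have hxT : Measurable fun ω => x (tail n fun k => c k ω) := hx.comp hT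
  have hyT : Measurable fun ω => y (tail n fun k => c k ω) := hy.comp hT
  have hrm := hr.cont.measurable
  have hA : Measurable fun ω => c 0 ω + x (tail n fun k => c k ω) := h0.add hxT
  ext E hE
  have hpre : MeasurableSet ((fun ω => c 0 ω + x (tail n fun k => c k ω)) ⁻¹' E) :=
    hA hE
  rw [Measure.map_apply hA hE, withDensity_apply _ hpre, withDensity_apply _ hE,
    ← lintegral_indicator hpre]
  have h1 : ∀ ω, ((fun ω => c 0 ω + x (tail n fun k => c k ω)) ⁻¹' E).indicator
      (fun ω => ENNReal.ofReal |y (tail n fun k => c k ω) + β * c 0 ω|) ω =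
      (fun q : ℝ × (ℕ → ℝ) => E.indicator 1 (q.1 + x q.2) * ENNReal.ofReal |y q.2 + β * q.1|)
        (c 0 ω, tail n fun k => c k ω) := by
    intro ω
    by_cases hω : c 0 ω + x (tail n fun k => c k ω) ∈ E
    · simp [Set.indicator, hω]
    · simp [Set.indicator, hω]
  have hFm : Measurable fun q : ℝ × (ℕ → ℝ) =>
      E.indicator (1 : ℝ → ENNReal) (q.1 + x q.2) * ENNReal.ofReal |y q.2 + β * q.1| := by
    have h2 : Measurable (E.indicator (1 : ℝ → ENNReal)) := measurable_one.indicator hE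
    exact (h2.comp (measurable_fst.add (hx.comp measurable_snd))).mul
      ((hy.comp measurable_snd).add (measurable_fst.const_mul β)).abs.ennreal_ofReal
  simp_rw [h1]
  rw [hc.lintegral_split hr n hFm]
  have h3 : ∀ ω, (∫⁻ v : ℝ, ENNReal.ofReal (r v) *
      (E.indicator (1 : ℝ → ENNReal) (v + x (tail n fun k => c k ω)) *
        ENNReal.ofReal |y (tail n fun k => c k ω) + β * v|)) =
      ∫⁻ u in E, ENNReal.ofReal (r (u - x (tail n fun k => c k ω)) *
        |y (tail n fun k => c k ω) + β * (u - x (tail n fun k => c k ω))|) := by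
    intro ω
    rw [← lintegral_indicator hE]
    refine Eq.trans ?_ (lintegral_add_right_eq_self _ (x (tail n fun k => c k ω)))
    refine lintegral_congr fun v => ?_
    by_cases hv : v + x (tail n fun k => c k ω) ∈ E
    · simp [Set.indicator, hv, ENNReal.ofReal_mul (hr.nonneg _)]
    · simp [Set.indicator, hv]
  simp_rw [h3]
  rw [lintegral_lintegral_swap]
  · refine lintegral_congr fun u => ?_
    rw [weightedDensity, ofReal_integral_eq_lintegral_ofReal
      (integrable_weightedDensity_integrand hr hX hY β u)
      (ae_of_all _ fun ω => mul_nonneg (hr.nonneg _) (abs_nonneg _))]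
  · refine Measurable.aemeasurable ?_
    refine Measurable.ennreal_ofReal ?_
    have h4 : Measurable fun q : Ω × ℝ => q.2 - x (tail n fun k => c k q.1) :=
      measurable_snd.sub (hxT.comp measurable_fst)
    exact (hrm.comp h4).mul ((hyT.comp measurable_fst).add (h4.const_mul β)).abs

/-- A weighted density at the origin through the twisted first absolute moments. -/
theorem IsEnsemble.weightedDensity_zero (hc : IsEnsemble P c r) (hr : AdmissibleDensity r a)
    (hx : Measurable x) (hy : Measurable y)
    (hX : Integrable (fun ω => x (tail n fun k => c k ω)) P)
    (hY : Integrable (fun ω => y (tail n fun k => c k ω)) P)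
    (hc0 : Integrable (c 0) P) (β : ℝ)
    {ψ : ℝ → ℂ} (hψ : ∀ w, ∫ ω, ((|y (tail n fun k => c k ω) + β * c 0 ω| : ℝ) : ℂ) *
      Complex.exp ((-2 * Real.pi * w * (c 0 ω + x (tail n fun k => c k ω)) : ℝ) * Complex.I) ∂P =
        ψ w)
    (hψi : Integrable ψ) :
    (weightedDensity P r (fun ω => x (tail n fun k => c k ω))
      (fun ω => y (tail n fun k => c k ω)) β 0 : ℂ) = ∫ w, ψ w := by
  have hT := hc.measurable_tail n
  have h0 := hc.meas 0
  have hxT : Measurable fun ω => x (tail n fun k => c k ω) := hx.comp hT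
  have hyT : Measurable fun ω => y (tail n fun k => c k ω) := hy.comp hT
  have hA : Measurable fun ω => c 0 ω + x (tail n fun k => c k ω) := h0.add hxT
  have hmap := hc.map_withDensity_eq hr hx hy hX hY β
  set W := weightedDensity P r (fun ω => x (tail n fun k => c k ω))
      (fun ω => y (tail n fun k => c k ω)) β with hW
  have hWc : Continuous W := continuous_weightedDensity hr hX hY β
  have hW0 : ∀ u, 0 ≤ W u := fun u => weightedDensity_nonneg hr β u
  have hYm : Measurable fun ω => |y (tail n fun k => c k ω) + β * c 0 ω| :=
    (hyT.add (h0.const_mul β)).abs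
  have hYi : Integrable (fun ω => |y (tail n fun k => c k ω) + β * c 0 ω|) P :=
    (hY.add (hc0.const_mul β)).abs
  -- The total mass of `W` is the first absolute moment of the weight.
  have hWi : Integrable W := by
    refine ⟨hWc.aestronglyMeasurable, ?_⟩
    rw [hasFiniteIntegral_iff_ofReal (ae_of_all _ hW0)]
    have h1 := DFunLike.congr_fun hmap Set.univ
    rw [Measure.map_apply hA MeasurableSet.univ, Set.preimage_univ,
      withDensity_apply _ MeasurableSet.univ, withDensity_apply _ MeasurableSet.univ,
      Measure.restrict_univ, Measure.restrict_univ] at h1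
    rw [← h1]
    exact (hasFiniteIntegral_iff_ofReal (ae_of_all _ fun ω => abs_nonneg _)).1 hYi.2
  refine apply_zero_eq_integral_fourier hWc hWi (fun w => ?_) hψi
  rw [← hψ, Real.fourier_real_eq_integral_exp_smul]
  have h2 : ∫ v : ℝ, Complex.exp (((-2 * Real.pi * v * w : ℝ) : ℂ) * Complex.I) • (W v : ℂ) =
      ∫ v, Complex.exp (((-2 * Real.pi * v * w : ℝ) : ℂ) * Complex.I)
        ∂(volume.withDensity fun u => ENNReal.ofReal (W u)) := by
    rw [integral_withDensity_eq_integral_toReal_smul hWc.measurable.ennreal_ofReal (by simp)]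
    refine integral_congr_ae (ae_of_all _ fun v => ?_)
    simp only [ENNReal.toReal_ofReal (hW0 v), Complex.real_smul, smul_eq_mul]
    rw [mul_comm]
  have hcont : Continuous fun v : ℝ =>
      Complex.exp (((-2 * Real.pi * v * w : ℝ) : ℂ) * Complex.I) := by fun_prop
  rw [h2, ← hmap, integral_map hA.aemeasurable hcont.aestronglyMeasurable,
    integral_withDensity_eq_integral_toReal_smul hYm.ennreal_ofReal (by simp)]
  refine integral_congr_ae (ae_of_all _ fun ω => ?_)
  simp only [ENNReal.toReal_ofReal (abs_nonneg _), Complex.real_smul]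
  congr 3
  push_cast
  ring

end Weighted

end SO2Ensemble

/-! ### Moments of linear forms in the coefficients -/

namespace SO2Ensemble

section Moments

variable {Ω : Type*} [MeasurableSpace Ω] {P : Measure Ω}
  {c : ℕ → Ω → ℝ} {r : ℝ → ℝ} {a : ℝ}

theorem IsEnsemble.memLp (hc : IsEnsemble P c r) (hr : AdmissibleDensity r a) (k : ℕ) :
    MemLp (c k) 2 P := by
  have h := hr.memLp
  rw [← hc.law_eq k] at h
  exact h.comp_of_map (hc.meas k).aemeasurable

theorem IsEnsemble.integral_eq_zero (hc : IsEnsemble P c r) (hr : AdmissibleDensity r a) (k : ℕ) :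
    ∫ ω, c k ω ∂P = 0 := by
  have h := hr.mean
  rwa [← hc.law_eq k, integral_map (hc.meas k).aemeasurable (by fun_prop)] at h

theorem IsEnsemble.integral_sq (hc : IsEnsemble P c r) (hr : AdmissibleDensity r a) (k : ℕ) :
    ∫ ω, c k ω ^ 2 ∂P = 1 := by
  have h := hr.second
  rwa [← hc.law_eq k, integral_map (hc.meas k).aemeasurable (by fun_prop)] at h

theorem IsEnsemble.integral_cexp_sum (hc : IsEnsemble P c r) (S : Finset ℕ) (u : ℕ → ℝ) :
    ∫ ω, Complex.exp ((∑ k ∈ S, u k * c k ω : ℝ) * Complex.I) ∂P =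
      ∏ k ∈ S, charFun (law r) (u k) := by
  have hm : ∀ k, AEMeasurable (fun ω => u k * c k ω) P := fun k =>
    ((hc.meas k).const_mul (u k)).aemeasurable
  have hind : iIndepFun (fun k ω => u k * c k ω) P :=
    hc.indep.comp (fun k x => u k * x) fun k => measurable_const_mul (u k)
  have h := iIndepFun.charFun_map_fun_finsetSum_eq_prod (s := S) (fun k _ => hm k)
    (hind.restrict _)
  have h1 := congrFun h 1
  rw [charFun_apply_real, integral_map (Finset.aemeasurable_fun_sum _ fun k _ => hm k)
    (by fun_prop), Finset.prod_apply] at h1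
  simp only [Complex.ofReal_one, one_mul] at h1
  rw [h1]
  refine Finset.prod_congr rfl fun k _ => ?_
  rw [charFun_map_mul_comp (hc.meas k).aemeasurable, mul_one, hc.law_eq k]

theorem IsEnsemble.integrable_mul (hc : IsEnsemble P c r) (hr : AdmissibleDensity r a) (i j : ℕ) :
    Integrable (fun ω => c i ω * c j ω) P :=
  (hc.memLp hr i).integrable_mul (hc.memLp hr j)

theorem IsEnsemble.integral_mul (hc : IsEnsemble P c r) (hr : AdmissibleDensity r a) (i j : ℕ) :
    ∫ ω, c i ω * c j ω ∂P = if i = j then 1 else 0 := by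
  split_ifs with h
  · subst h
    simp_rw [← sq]
    exact hc.integral_sq hr i
  · have := (hc.indep.indepFun h).integral_fun_mul_eq_mul_integral (hc.meas i).aestronglyMeasurable
      (hc.meas j).aestronglyMeasurable
    rw [this, hc.integral_eq_zero hr i, zero_mul]

theorem IsEnsemble.integral_sum_sq (hc : IsEnsemble P c r) (hr : AdmissibleDensity r a)
    (S : Finset ℕ) (u : ℕ → ℝ) :
    ∫ ω, (∑ k ∈ S, u k * c k ω) ^ 2 ∂P = ∑ k ∈ S, u k ^ 2 := by
  have h1 : ∀ ω, (∑ k ∈ S, u k * c k ω) ^ 2 =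
      ∑ i ∈ S, ∑ j ∈ S, u i * u j * (c i ω * c j ω) := fun ω => by
    rw [sq, Finset.sum_mul_sum]
    exact Finset.sum_congr rfl fun i _ => Finset.sum_congr rfl fun j _ => by ring
  simp_rw [h1]
  rw [integral_finsetSum _ fun i _ => integrable_finsetSum _ fun j _ =>
    (hc.integrable_mul hr i j).const_mul _]
  refine Finset.sum_congr rfl fun i hi => ?_
  rw [integral_finsetSum _ fun j _ => (hc.integrable_mul hr i j).const_mul _]
  simp_rw [integral_const_mul, hc.integral_mul hr]
  simp [hi, sq]

variable [IsProbabilityMeasure P]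

theorem IsEnsemble.integrable (hc : IsEnsemble P c r) (hr : AdmissibleDensity r a) (k : ℕ) :
    Integrable (c k) P :=
  (hc.memLp hr k).integrable (by norm_num)

theorem IsEnsemble.integrable_sum (hc : IsEnsemble P c r) (hr : AdmissibleDensity r a)
    (S : Finset ℕ) (u : ℕ → ℝ) : Integrable (fun ω => ∑ k ∈ S, u k * c k ω) P :=
  integrable_finsetSum _ fun k _ => (hc.integrable hr k).const_mul _

/-- Nonnegativity of the variance of the absolute value; the coefficients are orthonormal in `L²`.
-/
theorem IsEnsemble.integral_abs_sum_le (hc : IsEnsemble P c r) (hr : AdmissibleDensity r a)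
    (S : Finset ℕ) (u : ℕ → ℝ) :
    ∫ ω, |∑ k ∈ S, u k * c k ω| ∂P ≤ Real.sqrt (∑ k ∈ S, u k ^ 2) := by
  refine Real.le_sqrt_of_sq_le ?_
  rw [← hc.integral_sum_sq hr S u]
  set Z : Ω → ℝ := fun ω => |∑ k ∈ S, u k * c k ω| with hZ
  have hZL : MemLp Z 2 P :=
    (memLp_finsetSum S fun k _ => (hc.memLp hr k).const_mul (u k)).abs
  have h := variance_nonneg Z P
  rw [variance_eq_sub hZL] at h
  have h2 : ∫ ω, (Z ^ 2) ω ∂P = ∫ ω, (∑ k ∈ S, u k * c k ω) ^ 2 ∂P := by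
    simp [hZ, sq_abs]
  rw [h2] at h
  linarith

/-- The twisted first absolute moment of a pair of linear forms. -/
theorem IsEnsemble.integral_abs_mul_cexp (hc : IsEnsemble P c r) (hr : AdmissibleDensity r a)
    (S : Finset ℕ) (ξ η : ℕ → ℝ) (s : ℝ) :
    ∫ ω, ((|∑ k ∈ S, η k * c k ω| : ℝ) : ℂ) *
        Complex.exp ((s * ∑ k ∈ S, ξ k * c k ω : ℝ) * Complex.I) ∂P =
      (absConst : ℂ)⁻¹ * ∫ t : ℝ, secondDiff r S ξ η s t := by
  have hX : Measurable fun ω => s * ∑ k ∈ S, ξ k * c k ω :=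
    (Finset.measurable_fun_sum _ fun k _ => (hc.meas k).const_mul _).const_mul s
  have hY : Measurable fun ω => ∑ k ∈ S, η k * c k ω :=
    Finset.measurable_fun_sum _ fun k _ => (hc.meas k).const_mul _
  have h := absConst_mul_integral_abs_mul_cexp hX hY (hc.integrable_sum hr S η)
  have h1 : ∀ t : ℝ, ∫ ω, Complex.exp ((s * (∑ k ∈ S, ξ k * c k ω) +
      t * (∑ k ∈ S, η k * c k ω) : ℝ) * Complex.I) ∂P = jointChar r S ξ η s t := fun t => by
    rw [jointChar, ← hc.integral_cexp_sum S fun k => s * ξ k + t * η k]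
    congr 1
    funext ω
    congr 3
    rw [Finset.mul_sum, Finset.mul_sum, ← Finset.sum_add_distrib]
    exact Finset.sum_congr rfl fun k _ => by ring
  have h0 : ∫ ω, Complex.exp ((s * (∑ k ∈ S, ξ k * c k ω) : ℝ) * Complex.I) ∂P =
      jointChar r S ξ η s 0 := by
    rw [← h1 0]
    simp
  simp only [h1, h0] at h
  have hne : (absConst : ℂ) ≠ 0 := by exact_mod_cast absConst_pos.ne'
  rw [eq_inv_mul_iff_mul_eq₀ hne, h]
  rfl

end Moments

/-! ### Normalized coefficients of the value and the slope -/

section Normalized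

/-- The binomial parameter attached to a point of the line. -/
noncomputable def param (x : ℝ) : ℝ := x ^ 2 / (1 + x ^ 2)

/-- The normalized coefficients of the value of the polynomial. -/
noncomputable def valueCoeff (n : ℕ) (x : ℝ) (k : ℕ) : ℝ :=
  Real.sqrt (n.choose k) * x ^ k / Real.sqrt ((1 + x ^ 2) ^ n)

/-- The normalized coefficients of the part of the derivative uncorrelated with the value. -/
noncomputable def slopeCoeff (n : ℕ) (x : ℝ) (k : ℕ) : ℝ :=
  valueCoeff n x k * (k - n * param x) / Real.sqrt (n * param x * (1 - param x))

theorem one_sub_param (x : ℝ) : 1 - param x = 1 / (1 + x ^ 2) := by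
  have : (1 + x ^ 2) ≠ 0 := by positivity
  unfold param
  field_simp
  ring

theorem param_pos {x : ℝ} (hx : x ≠ 0) : 0 < param x := by
  unfold param
  positivity

theorem param_le_half {x : ℝ} (hx : |x| ≤ 1) : param x ≤ 1 / 2 := by
  have h := sq_le_one_iff_abs_le_one x |>.2 hx
  rw [param, div_le_div_iff₀ (by positivity) (by norm_num)]
  linarith

theorem variance_eq (n : ℕ) (x : ℝ) :
    n * param x * (1 - param x) = n * x ^ 2 / (1 + x ^ 2) ^ 2 := by
  rw [one_sub_param, param]
  field_simp

theorem variance_pos {n : ℕ} (hn : 0 < n) {x : ℝ} (hx : x ≠ 0) :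
    0 < n * param x * (1 - param x) := by
  rw [variance_eq]
  have : (0 : ℝ) < n := by exact_mod_cast hn
  positivity

theorem valueCoeff_sq {n k : ℕ} (hk : k ≤ n) (x : ℝ) :
    valueCoeff n x k ^ 2 = binom n (param x) k := by
  obtain ⟨d, rfl⟩ := Nat.exists_eq_add_of_le hk
  have h : (0 : ℝ) < 1 + x ^ 2 := by positivity
  rw [valueCoeff, div_pow, mul_pow, Real.sq_sqrt (by positivity), Real.sq_sqrt (by positivity),
    binom, one_sub_param, param, Nat.add_sub_cancel_left]
  rw [div_pow, div_pow, one_pow, pow_add (1 + x ^ 2) k d, ← pow_mul, ← pow_mul, mul_comm k 2]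
  field_simp

theorem slopeCoeff_sq {n k : ℕ} (hk : k ≤ n) (x : ℝ) :
    slopeCoeff n x k ^ 2 = ((k - n * param x) ^ 2 * binom n (param x) k) /
      (n * param x * (1 - param x)) := by
  have h : 0 ≤ n * param x * (1 - param x) := by
    rw [variance_eq]; positivity
  rw [slopeCoeff, div_pow, mul_pow, Real.sq_sqrt h, valueCoeff_sq hk, mul_comm (binom _ _ _)]

/-- The three conditions are the total mass, the variance and the vanishing first central moment of
the binomial distribution. -/
theorem frame_coeff {n : ℕ} (hn : 0 < n) {x : ℝ} (hx : x ≠ 0) :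
    Frame (Finset.range (n + 1)) (valueCoeff n x) (slopeCoeff n x) := by
  have hV := variance_pos hn hx
  refine ⟨?_, ?_, ?_⟩
  · rw [← sum_binom n (param x)]
    exact Finset.sum_congr rfl fun k hk => valueCoeff_sq (by simpa [Nat.lt_succ_iff] using hk) x
  · rw [Finset.sum_congr rfl fun k hk => slopeCoeff_sq (by simpa [Nat.lt_succ_iff] using hk) x,
      ← Finset.sum_div, sum_sub_sq_mul_binom, div_self hV.ne']
  · have : ∀ k ∈ Finset.range (n + 1), valueCoeff n x k * slopeCoeff n x k =
        ((k - n * param x) * binom n (param x) k) / Real.sqrt (n * param x * (1 - param x)) := by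
      intro k hk
      rw [← valueCoeff_sq (by simpa [Nat.lt_succ_iff] using hk) x, slopeCoeff]
      ring
    rw [Finset.sum_congr rfl this, ← Finset.sum_div, sum_sub_mul_binom, zero_div]

/-- The normalized coefficients are uniformly small when the variance is large. -/
theorem exists_coeff_sq_le {δ : ℝ} (hδ : 0 < δ) :
    ∃ L : ℝ, 0 < L ∧ ∀ (n : ℕ) (x : ℝ), x ≠ 0 → |x| ≤ 1 → L ≤ n * x ^ 2 →
      ∀ k ∈ Finset.range (n + 1), valueCoeff n x k ^ 2 + slopeCoeff n x k ^ 2 ≤ δ := by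
  obtain ⟨V₀, hV₀, h⟩ := exists_binom_mul_le hδ
  -- For `|x| ≤ 1` the variance `n x² / (1 + x²)²` is at least `n x² / 4`.
  refine ⟨4 * V₀, by linarith, fun n x hx hx1 hL k hk => ?_⟩
  have hk' : k ≤ n := by simpa [Nat.lt_succ_iff] using hk
  have hV : V₀ ≤ n * param x * (1 - param x) := by
    rw [variance_eq, le_div_iff₀ (by positivity)]
    have h1 := sq_le_one_iff_abs_le_one x |>.2 hx1
    have h2 : (1 + x ^ 2) ^ 2 ≤ 4 := by nlinarith [sq_nonneg x]
    nlinarith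
  have := h (param x) n k (param_pos hx) (param_le_half hx1) hV hk'
  rw [valueCoeff_sq hk', slopeCoeff_sq hk']
  refine le_trans (le_of_eq ?_) this
  ring

end Normalized

/-! ### The intensity: Fourier form, uniform bound, limit -/

section Intensity

variable {Ω : Type*} [MeasurableSpace Ω] {P : Measure Ω} [IsProbabilityMeasure P]
  {c : ℕ → Ω → ℝ} {r : ℝ → ℝ} {a : ℝ}

theorem poly_eq_valueCoeff (c : ℕ → ℝ) (n : ℕ) (x : ℝ) :
    poly c n x = Real.sqrt ((1 + x ^ 2) ^ n) *
      ∑ k ∈ Finset.range (n + 1), valueCoeff n x k * c k := by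
  have h : Real.sqrt ((1 + x ^ 2) ^ n) ≠ 0 := by positivity
  rw [poly, Finset.mul_sum]
  refine Finset.sum_congr rfl fun k _ => ?_
  unfold valueCoeff
  field_simp

/-- `n * param x / x` is the regression coefficient of the derivative on the value: differentiating
multiplies the `k`-th term by `k / x`, and subtraction centres `k` at its binomial mean. -/
theorem polyDeriv_sub_eq_slopeCoeff (c : ℕ → ℝ) {n : ℕ} (hn : 0 < n) {x : ℝ} (hx : x ≠ 0) :
    polyDeriv c n x - n * param x / x * poly c n x =
      Real.sqrt ((1 + x ^ 2) ^ n) * Real.sqrt (n * param x * (1 - param x)) / x *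
        ∑ k ∈ Finset.range (n + 1), slopeCoeff n x k * c k := by
  have h : Real.sqrt ((1 + x ^ 2) ^ n) ≠ 0 := by positivity
  have hV : Real.sqrt (n * param x * (1 - param x)) ≠ 0 :=
    (Real.sqrt_pos.2 (variance_pos hn hx)).ne'
  rw [poly, polyDeriv, Finset.mul_sum, Finset.mul_sum, ← Finset.sum_sub_distrib]
  refine Finset.sum_congr rfl fun k _ => ?_
  have hk : (k : ℝ) * x ^ (k - 1) = k * x ^ k / x := by
    cases k with
    | zero => simp
    | succ k => rw [Nat.add_sub_cancel, pow_succ]; field_simp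
  rw [hk]
  unfold slopeCoeff valueCoeff
  field_simp

/-- At level `0` one has `c 0 = -poly (tail …)`, so subtracting `α` times the value of the
polynomial leaves the weight unchanged. Thus `α` is free. -/
theorem intensity_eq_weightedDensity (hc : IsEnsemble P c r) (hr : AdmissibleDensity r a)
    (n : ℕ) (x α : ℝ) :
    intensity P c r n x = ENNReal.ofReal (weightedDensity P r
      (fun ω => poly (tail n fun k => c k ω) n x)
      (fun ω => polyDeriv (tail n fun k => c k ω) n x - α * poly (tail n fun k => c k ω) n x)
      (-α) 0) := by
  have hp : Integrable (fun ω => poly (fun k => c k ω) n x) P := by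
    unfold poly
    refine integrable_finsetSum _ fun k _ => Integrable.mul_const ?_ _
    exact (hc.integrable hr k).const_mul _
  have hp' : Integrable (fun ω => poly (tail n fun k => c k ω) n x) P := by
    have : (fun ω => poly (tail n fun k => c k ω) n x) =
        fun ω => poly (fun k => c k ω) n x - c 0 ω := by
      funext ω
      rw [poly_eq_add_tail (fun k => c k ω)]; ring
    rw [this]
    exact hp.sub (hc.integrable hr 0)
  have hd : Integrable (fun ω => polyDeriv (tail n fun k => c k ω) n x) P := by
    simp_rw [polyDeriv_tail]
    unfold polyDeriv
    refine integrable_finsetSum _ fun k _ => Integrable.mul_const ?_ _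
    exact (hc.integrable hr k).const_mul _
  have hY : Integrable (fun ω => polyDeriv (tail n fun k => c k ω) n x -
      α * poly (tail n fun k => c k ω) n x) P := hd.sub (hp'.const_mul α)
  rw [weightedDensity, ofReal_integral_eq_lintegral_ofReal
    (integrable_weightedDensity_integrand hr hp' hY (-α) 0)
    (ae_of_all _ fun ω => mul_nonneg (hr.nonneg _) (abs_nonneg _)), intensity]
  refine lintegral_congr fun ω => ?_
  rw [ENNReal.ofReal_mul (hr.nonneg _), mul_comm]
  congr 3
  · ring
  · rw [polyDeriv_tail]; ring

/-- The intensity through the normalized Fourier expression. -/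
theorem IsEnsemble.intensity_eq_fourierIntensity (hc : IsEnsemble P c r)
    (hr : AdmissibleDensity r a) {n : ℕ} (hn : 0 < n) {x : ℝ} (hx : x ≠ 0)
    (hsmall : ∀ k ∈ Finset.range (n + 1), valueCoeff n x k ^ 2 + slopeCoeff n x k ^ 2 ≤ 1 / 4) :
    ∃ w : ℝ, intensity P c r n x = ENNReal.ofReal w ∧
      (w : ℂ) = (Real.sqrt n / (1 + x ^ 2) : ℝ) *
        fourierIntensity r (Finset.range (n + 1)) (valueCoeff n x) (slopeCoeff n x) := by
  set α : ℝ := n * param x / x with hα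
  set S := Finset.range (n + 1)
  set σ := Real.sqrt ((1 + x ^ 2) ^ n) with hσ
  have hσ0 : 0 < σ := Real.sqrt_pos.2 (by positivity)
  set s := Real.sqrt (n * param x * (1 - param x)) with hs
  have hs0 : 0 < s := Real.sqrt_pos.2 (variance_pos hn hx)
  refine ⟨_, intensity_eq_weightedDensity hc hr n x α, ?_⟩
  have hm1 : Measurable fun z : ℕ → ℝ => poly z n x :=
    (continuous_poly n).measurable.comp (measurable_id.prodMk measurable_const)
  have hm2 : Measurable fun z : ℕ → ℝ => polyDeriv z n x :=
    (continuous_polyDeriv n).measurable.comp (measurable_id.prodMk measurable_const)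
  have hp' : Integrable (fun ω => poly (tail n fun k => c k ω) n x) P := by
    have : (fun ω => poly (tail n fun k => c k ω) n x) =
        fun ω => σ * (∑ k ∈ S, valueCoeff n x k * c k ω) - c 0 ω := by
      funext ω
      rw [← poly_eq_valueCoeff (fun k => c k ω), poly_eq_add_tail (fun k => c k ω)]; ring
    rw [this]
    exact ((hc.integrable_sum hr S _).const_mul σ).sub (hc.integrable hr 0)
  have hA : ∀ ω, poly (fun k => c k ω) n x = σ * ∑ k ∈ S, valueCoeff n x k * c k ω :=
    fun ω => poly_eq_valueCoeff (fun k => c k ω) n x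
  have hB : ∀ ω, polyDeriv (tail n fun k => c k ω) n x - α * poly (tail n fun k => c k ω) n x +
      -α * c 0 ω = σ * s / x * ∑ k ∈ S, slopeCoeff n x k * c k ω := fun ω => by
    rw [← polyDeriv_sub_eq_slopeCoeff (fun k => c k ω) hn hx, polyDeriv_tail,
      poly_eq_add_tail (fun k => c k ω)]
    ring
  have hy : Integrable (fun ω => polyDeriv (tail n fun k => c k ω) n x -
      α * poly (tail n fun k => c k ω) n x) P := by
    have : (fun ω => polyDeriv (tail n fun k => c k ω) n x -
        α * poly (tail n fun k => c k ω) n x) =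
        fun ω => σ * s / x * (∑ k ∈ S, slopeCoeff n x k * c k ω) - -α * c 0 ω := by
      funext ω
      rw [← hB]; ring
    rw [this]
    exact ((hc.integrable_sum hr S _).const_mul _).sub ((hc.integrable hr 0).const_mul _)
  have hF := frame_coeff hn hx
  have hI : Integrable fun w : ℝ =>
      ∫ t : ℝ, secondDiff r S (valueCoeff n x) (slopeCoeff n x) (-2 * Real.pi * w) t := by
    refine hr.integrable_bound.mono' ?_
      (ae_of_all _ fun w => hr.norm_integral_secondDiff_le hF hsmall _)
    exact ((hr.stronglyMeasurable_integral_secondDiff S (valueCoeff n x)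
      (slopeCoeff n x)).comp_measurable (by fun_prop)).aestronglyMeasurable
  set G : ℝ → ℂ := fun w => ((σ * s / |x| : ℝ) : ℂ) * ((absConst : ℂ)⁻¹ *
    ∫ t : ℝ, secondDiff r S (valueCoeff n x) (slopeCoeff n x) (-2 * Real.pi * w) t) with hG
  have hGi : Integrable G := (hI.const_mul _).const_mul _
  -- The value is `σ` times its normalized form, so frequencies are rescaled by `σ`. The Jacobian
  -- `σ⁻¹` then cancels the factor `σ` of the slope and leaves `s / |x| = √n / (1 + x²)`.
  have key := hc.weightedDensity_zero hr (n := n) hm1 (hm2.sub (hm1.const_mul α)) hp' hy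
    (hc.integrable hr 0) (-α) (ψ := fun w => G (w * σ)) (fun w => by
      simp only [hG]
      rw [show -2 * Real.pi * (w * σ) = (-2 * Real.pi * w * σ) by ring,
        ← hc.integral_abs_mul_cexp hr, ← integral_const_mul]
      refine integral_congr_ae (ae_of_all _ fun ω => ?_)
      simp only [Pi.sub_apply]
      rw [hB, abs_mul, abs_div, abs_of_pos (by positivity : 0 < σ * s),
        ← poly_eq_add_tail (fun k => c k ω), hA]
      push_cast
      ring_nf) (hGi.comp_mul_right' hσ0.ne')
  refine key.trans ?_
  rw [Measure.integral_comp_mul_right G, hG, integral_const_mul, integral_const_mul,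
    fourierIntensity, abs_of_pos (inv_pos.2 hσ0), Complex.real_smul]
  have hval : σ⁻¹ * (σ * s / |x|) = Real.sqrt n / (1 + x ^ 2) := by
    have h1 : s = Real.sqrt n * |x| / (1 + x ^ 2) := by
      rw [hs, variance_eq, Real.sqrt_div (by positivity), Real.sqrt_mul (by positivity),
        Real.sqrt_sq_eq_abs, Real.sqrt_sq (by positivity)]
    have hx' : |x| ≠ 0 := abs_ne_zero.2 hx
    rw [h1]
    field_simp
  rw [← hval]
  push_cast
  ring

/-- The bound of the intensity by the second moment of the derivative. -/
theorem IsEnsemble.intensity_le_of_mul_sq_le (hc : IsEnsemble P c r) (hr : AdmissibleDensity r a)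
    {M : ℝ} (hM : ∀ t, r t ≤ M) {n : ℕ} {x L : ℝ} (hx : x ≠ 0) (hL : n * x ^ 2 ≤ L) :
    intensity P c r n x ≤ ENNReal.ofReal (M * Real.sqrt ((1 + L) * Real.exp L) * Real.sqrt n) := by
  have hM0 : 0 ≤ M := (hr.nonneg 0).trans (hM 0)
  have hL0 : 0 ≤ L := le_trans (by positivity) hL
  set S := Finset.range (n + 1)
  set u : ℕ → ℝ := fun k => Real.sqrt (n.choose k) * (k * x ^ (k - 1)) with hu
  have hd : ∀ ω, polyDeriv (fun k => c k ω) n x = ∑ k ∈ S, u k * c k ω := fun ω => by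
    rw [polyDeriv]
    exact Finset.sum_congr rfl fun k _ => by simp only [hu]; ring
  -- Up to the factor `(1 + x²)^n / x²` this is the binomial second moment; `(1 + x²)^n ≤ exp (n
  -- x²)` keeps it under control.
  have hsum : ∑ k ∈ S, u k ^ 2 ≤ n * ((1 + L) * Real.exp L) := by
    have h1 : ∀ k ∈ S, u k ^ 2 =
        (1 + x ^ 2) ^ n / x ^ 2 * ((k : ℝ) ^ 2 * binom n (param x) k) := by
      intro k hk
      have hk' : k ≤ n := by simpa [S, Nat.lt_succ_iff] using hk
      rw [← valueCoeff_sq hk', valueCoeff, div_pow, Real.sq_sqrt (by positivity)]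
      have hk2 : (k : ℝ) * x ^ (k - 1) = k * x ^ k / x := by
        cases k with
        | zero => simp
        | succ k => rw [Nat.add_sub_cancel, pow_succ]; field_simp
      simp only [hu, hk2]
      field_simp
    rw [Finset.sum_congr rfl h1, ← Finset.mul_sum, sum_sq_mul_binom, variance_eq, param]
    have h2 : (1 + x ^ 2) ^ n / x ^ 2 * (n * x ^ 2 / (1 + x ^ 2) ^ 2 +
        (n * (x ^ 2 / (1 + x ^ 2))) ^ 2) =
        n * ((1 + n * x ^ 2) * ((1 + x ^ 2) ^ n / (1 + x ^ 2) ^ 2)) := by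
      field_simp
    rw [h2]
    have h3 : (1 + x ^ 2) ^ n ≤ Real.exp L := by
      calc (1 + x ^ 2) ^ n ≤ (Real.exp (x ^ 2)) ^ n := by
            refine pow_le_pow_left₀ (by positivity) ?_ n
            linarith [Real.add_one_le_exp (x ^ 2)]
        _ = Real.exp (n * x ^ 2) := (Real.exp_nat_mul _ _).symm
        _ ≤ Real.exp L := Real.exp_le_exp.2 hL
    have h4 : (1 + x ^ 2) ^ n / (1 + x ^ 2) ^ 2 ≤ Real.exp L := by
      refine (div_le_self (by positivity) ?_).trans h3
      exact one_le_pow₀ (by linarith [sq_nonneg x])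
    refine mul_le_mul_of_nonneg_left ?_ (by positivity)
    exact mul_le_mul (by linarith) h4 (by positivity) (by linarith)
  have habs := hc.integral_abs_sum_le hr S u
  have hint := hc.integrable_sum hr S u
  calc intensity P c r n x
      ≤ ∫⁻ ω, ENNReal.ofReal (M * |∑ k ∈ S, u k * c k ω|) ∂P := by
        unfold intensity
        refine lintegral_mono fun ω => ?_
        rw [hd, ← ENNReal.ofReal_mul (abs_nonneg _), mul_comm M]
        exact ENNReal.ofReal_le_ofReal (mul_le_mul_of_nonneg_left (hM _) (abs_nonneg _))
    _ = ENNReal.ofReal (∫ ω, M * |∑ k ∈ S, u k * c k ω| ∂P) :=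
        (ofReal_integral_eq_lintegral_ofReal (hint.abs.const_mul M)
          (ae_of_all _ fun ω => by positivity)).symm
    _ ≤ _ := by
        refine ENNReal.ofReal_le_ofReal ?_
        rw [integral_const_mul, mul_assoc]
        refine mul_le_mul_of_nonneg_left (habs.trans ?_) hM0
        rw [← Real.sqrt_mul (by positivity), mul_comm _ (n : ℝ)]
        exact Real.sqrt_le_sqrt hsum

/-- The uniform bound for the intensity on the unit interval. -/
theorem AdmissibleDensity.exists_intensity_le (hr : AdmissibleDensity r a)
    (P : Measure Ω) [IsProbabilityMeasure P] :
    ∃ C : ℝ, ∀ c : ℕ → Ω → ℝ, IsEnsemble P c r → ∀ (n : ℕ) (x : ℝ), 0 < n → x ≠ 0 → |x| ≤ 1 →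
      intensity P c r n x ≤ ENNReal.ofReal (C * Real.sqrt n) := by
  obtain ⟨M, hM0, hM⟩ := hr.exists_bound
  obtain ⟨L, hL0, hL⟩ := exists_coeff_sq_le (δ := 1 / 4) (by norm_num)
  obtain ⟨C, hC⟩ := hr.exists_norm_fourierIntensity_le
  refine ⟨max (M * Real.sqrt ((1 + L) * Real.exp L)) C, fun c hc n x hn hx hx1 => ?_⟩
  -- Near the origin the normalized coefficients need not be small, so the second-moment bound
  -- replaces the Fourier one.
  rcases le_total (n * x ^ 2) L with h | h
  · refine (hc.intensity_le_of_mul_sq_le hr hM hx h).trans (ENNReal.ofReal_le_ofReal ?_)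
    exact mul_le_mul_of_nonneg_right (le_max_left _ _) (Real.sqrt_nonneg _)
  · have hsmall := hL n x hx hx1 h
    obtain ⟨w, hw, hw'⟩ := hc.intensity_eq_fourierIntensity hr hn hx hsmall
    rw [hw]
    refine ENNReal.ofReal_le_ofReal ?_
    have h1 := hC _ _ _ (frame_coeff hn hx) hsmall
    have h2 : w ≤ ‖(w : ℂ)‖ := by rw [Complex.norm_real]; exact le_abs_self _
    refine h2.trans ?_
    rw [hw', norm_mul, Complex.norm_real, Real.norm_of_nonneg (by positivity), mul_comm]
    have h3 : Real.sqrt n / (1 + x ^ 2) ≤ Real.sqrt n :=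
      div_le_self (Real.sqrt_nonneg _) (by linarith [sq_nonneg x])
    exact mul_le_mul (h1.trans (le_max_right _ _)) h3 (by positivity)
      ((norm_nonneg _).trans (h1.trans (le_max_right _ _)))

/-- The pointwise limit of the rescaled intensity. -/
theorem AdmissibleDensity.tendsto_intensity (hr : AdmissibleDensity r a)
    {C : ℕ → ℕ → Ω → ℝ} (hC : ∀ n, IsEnsemble P (C n) r) {x : ℝ} (hx : x ≠ 0) (hx1 : |x| ≤ 1) :
    Tendsto (fun n : ℕ => ENNReal.ofReal (1 / Real.sqrt n) * intensity P (C n) r n x) atTop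
      (𝓝 (ENNReal.ofReal (Real.pi⁻¹ * (1 + x ^ 2)⁻¹))) := by
  have hlarge : ∀ L : ℝ, ∀ᶠ n : ℕ in atTop, L ≤ n * x ^ 2 := fun L =>
    (tendsto_natCast_atTop_atTop.atTop_mul_const (by positivity)).eventually_ge_atTop L
  have hs : ∀ δ > 0, ∀ᶠ n : ℕ in atTop, ∀ k ∈ Finset.range (n + 1),
      valueCoeff n x k ^ 2 + slopeCoeff n x k ^ 2 ≤ δ := fun δ hδ => by
    obtain ⟨L, _, hL⟩ := exists_coeff_sq_le hδ
    filter_upwards [hlarge L] with n hn using hL n x hx hx1 hn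
  have hF : ∀ᶠ n : ℕ in atTop,
      Frame (Finset.range (n + 1)) (valueCoeff n x) (slopeCoeff n x) := by
    filter_upwards [eventually_gt_atTop 0] with n hn using frame_coeff hn hx
  have hlim := (Complex.continuous_re.tendsto _).comp (hr.tendsto_fourierIntensity hF hs)
  have hre : (1 / Real.pi : ℂ).re = Real.pi⁻¹ := by
    rw [one_div, ← Complex.ofReal_inv, Complex.ofReal_re]
  rw [hre] at hlim
  refine (ENNReal.tendsto_ofReal (hlim.mul_const ((1 + x ^ 2)⁻¹))).congr' ?_
  filter_upwards [eventually_gt_atTop 0, hs (1 / 4) (by norm_num)] with n hn hsmall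
  obtain ⟨w, hw, hw'⟩ := (hC n).intensity_eq_fourierIntensity hr hn hx hsmall
  have hre2 : w = Real.sqrt n / (1 + x ^ 2) * (fourierIntensity r (Finset.range (n + 1))
      (valueCoeff n x) (slopeCoeff n x)).re := by
    rw [← Complex.re_ofReal_mul, ← hw', Complex.ofReal_re]
  have hn0 : 0 < Real.sqrt n := Real.sqrt_pos.2 (by exact_mod_cast hn)
  rw [hw, ← ENNReal.ofReal_mul (by positivity), hre2]
  congr 1
  simp only [Function.comp]
  field_simp

/-- The expected number of zeros in the unit interval, for a sequence of ensembles. -/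
theorem AdmissibleDensity.tendsto_encard_Icc (hr : AdmissibleDensity r a)
    {C : ℕ → ℕ → Ω → ℝ} (hC : ∀ n, IsEnsemble P (C n) r) :
    Tendsto (fun n : ℕ => ENNReal.ofReal (1 / Real.sqrt n) *
      ∫⁻ ω, ((Set.Icc (-1) 1 ∩ realZeros (fun k => C n k ω) n).encard : ENNReal) ∂P) atTop
      (𝓝 (ENNReal.ofReal (1 / 2))) := by
  obtain ⟨K, hK⟩ := hr.exists_intensity_le P
  have hlim : ∫⁻ x in Set.Icc (-1 : ℝ) 1, ENNReal.ofReal (Real.pi⁻¹ * (1 + x ^ 2)⁻¹) =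
      ENNReal.ofReal (1 / 2) := by
    rw [← ofReal_integral_eq_lintegral_ofReal
      (integrable_inv_one_add_sq.const_mul _).integrableOn (ae_of_all _ fun x => by positivity),
      integral_const_mul, integral_Icc_eq_integral_Ioc,
      ← intervalIntegral.integral_of_le (by norm_num), integral_inv_one_add_sq,
      Real.arctan_neg, Real.arctan_one]
    congr 1
    have := Real.pi_ne_zero
    field_simp
    norm_num
  rw [← hlim]
  have hrw : ∀ n : ℕ, ENNReal.ofReal (1 / Real.sqrt n) *
      ∫⁻ ω, ((Set.Icc (-1) 1 ∩ realZeros (fun k => C n k ω) n).encard : ENNReal) ∂P =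
      ∫⁻ x in Set.Icc (-1 : ℝ) 1, ENNReal.ofReal (1 / Real.sqrt n) * intensity P (C n) r n x := by
    intro n
    rw [(hC n).lintegral_encard hr n measurableSet_Icc,
      lintegral_const_mul _ ((hC n).measurable_intensity hr n)]
  simp_rw [hrw]
  have hne : ∀ᵐ x ∂(volume.restrict (Set.Icc (-1 : ℝ) 1)), x ≠ 0 ∧ |x| ≤ 1 := by
    have h0 : ∀ᵐ x : ℝ, x ≠ 0 := by simp [ae_iff]
    filter_upwards [ae_restrict_of_ae h0, ae_restrict_mem measurableSet_Icc] with x hx hx1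
    exact ⟨hx, abs_le.2 hx1⟩
  refine tendsto_lintegral_filter_of_dominated_convergence' (fun _ => ENNReal.ofReal K) ?_ ?_ ?_ ?_
  · exact Eventually.of_forall fun n =>
      (((hC n).measurable_intensity hr n).const_mul _).aemeasurable
  · filter_upwards [eventually_gt_atTop 0] with n hn
    filter_upwards [hne] with x hx
    refine (mul_le_mul_right (hK _ (hC n) n x hn hx.1 hx.2) _).trans ?_
    have hn0 : 0 < Real.sqrt n := Real.sqrt_pos.2 (by exact_mod_cast hn)
    rw [← ENNReal.ofReal_mul (by positivity)]
    refine ENNReal.ofReal_le_ofReal (le_of_eq ?_)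
    field_simp
  · simp [ENNReal.mul_eq_top]
  · filter_upwards [hne] with x hx
    exact hr.tendsto_intensity hC hx.1 hx.2

end Intensity

end SO2Ensemble

/-! ### Reversal of the coefficients and conclusion -/

namespace SO2Ensemble

/-- The reversal of the indices `0, …, n`. -/
def revIndex (n k : ℕ) : ℕ := if k ≤ n then n - k else k

theorem revIndex_injective (n : ℕ) : Function.Injective (revIndex n) := by
  intro i j h
  unfold revIndex at h
  split_ifs at h <;> omega

theorem poly_eq_pow_mul_poly_rev (c : ℕ → ℝ) (n : ℕ) {x : ℝ} (hx : x ≠ 0) :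
    poly c n x = x ^ n * poly (fun k => c (revIndex n k)) n x⁻¹ := by
  unfold poly
  rw [← Finset.sum_flip, Finset.mul_sum]
  refine Finset.sum_congr rfl fun k hk => ?_
  have hk' : k ≤ n := by simpa [Nat.lt_succ_iff] using hk
  have hrev : revIndex n k = n - k := if_pos hk'
  simp only [hrev, Nat.choose_symm hk', pow_sub₀ x hx hk', inv_pow]
  ring

/-- The map `x ↦ x⁻¹` is a bijection between the two zero sets; `0` is excluded because it
corresponds to the point at infinity. -/
theorem encard_realZeros_outer (c : ℕ → ℝ) (n : ℕ) :
    ((Set.Icc (-1) 1)ᶜ ∩ realZeros c n).encard =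
      ((Set.Ioo (-1) 1 \ {0}) ∩ realZeros (fun k => c (revIndex n k)) n).encard := by
  have hmem : ∀ x : ℝ, x ≠ 0 → (x ∈ (Set.Icc (-1 : ℝ) 1)ᶜ ↔ x⁻¹ ∈ Set.Ioo (-1 : ℝ) 1) := by
    intro x hx
    rw [Set.mem_compl_iff, Set.mem_Icc, Set.mem_Ioo, ← abs_le, ← abs_lt, not_le, abs_inv,
      inv_lt_one₀ (abs_pos.2 hx)]
  have himage : (Set.Icc (-1) 1)ᶜ ∩ realZeros c n =
      Inv.inv '' ((Set.Ioo (-1) 1 \ {0}) ∩ realZeros (fun k => c (revIndex n k)) n) := by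
    ext x
    simp only [Set.mem_inter_iff, Set.mem_image, Set.mem_sdiff, Set.mem_singleton_iff]
    constructor
    · rintro ⟨hx, h0⟩
      have hne : x ≠ 0 := by
        rintro rfl
        exact hx ⟨by norm_num, by norm_num⟩
      refine ⟨x⁻¹, ⟨⟨(hmem x hne).1 hx, inv_ne_zero hne⟩, ?_⟩, inv_inv x⟩
      have h1 : poly c n x = 0 := h0
      rw [poly_eq_pow_mul_poly_rev c n hne] at h1
      exact (mul_eq_zero.1 h1).resolve_left (pow_ne_zero n hne)
    · rintro ⟨y, ⟨⟨hy, hne⟩, h0⟩, rfl⟩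
      have hne' : y⁻¹ ≠ 0 := inv_ne_zero hne
      refine ⟨(hmem _ hne').2 (by rwa [inv_inv]), ?_⟩
      have h1 : poly (fun k => c (revIndex n k)) n y = 0 := h0
      have : poly c n y⁻¹ = 0 := by
        rw [poly_eq_pow_mul_poly_rev c n hne', inv_inv, h1, mul_zero]
      exact this
  rw [himage, inv_injective.encard_image]

section Main

variable {Ω : Type*} [MeasurableSpace Ω] {P : Measure Ω}
  {c : ℕ → Ω → ℝ} {r : ℝ → ℝ} {a : ℝ}

theorem IsEnsemble.rev (hc : IsEnsemble P c r) (n : ℕ) :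
    IsEnsemble P (fun k => c (revIndex n k)) r :=
  ⟨fun _ => hc.meas _, hc.indep.precomp (revIndex_injective n), fun _ => hc.law_eq _⟩

theorem lintegral_ofReal_eq_of_isRealZeroDensity {n : ℕ} {p : ℝ → ℝ}
    (hp : IsRealZeroDensity P c n p) :
    ∫⁻ x, ENNReal.ofReal (p x) =
      ∫⁻ ω, ((realZeros (fun k => c k ω) n).encard : ENNReal) ∂P := by
  have := hp.2.2 Set.univ MeasurableSet.univ
  simpa using this.symm

theorem IsEnsemble.aemeasurable_encard_realZeros (hc : IsEnsemble P c r) (n : ℕ) :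
    AEMeasurable (fun ω => ((realZeros (fun k => c k ω) n).encard : ENNReal)) P := by
  simpa using hc.aemeasurable_encard n MeasurableSet.univ

variable [IsProbabilityMeasure P]

/-- The origin and the endpoints are null, so they carry no expected zeros. -/
theorem IsEnsemble.lintegral_encard_outer (hc : IsEnsemble P c r) (hr : AdmissibleDensity r a)
    (n : ℕ) :
    ∫⁻ ω, (((Set.Icc (-1) 1)ᶜ ∩ realZeros (fun k => c k ω) n).encard : ENNReal) ∂P =
      ∫⁻ ω, ((Set.Icc (-1) 1 ∩ realZeros (fun k => c (revIndex n k) ω) n).encard : ENNReal) ∂P := by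
  simp_rw [encard_realZeros_outer]
  rw [(hc.rev n).lintegral_encard hr n (measurableSet_Ioo.diff (measurableSet_singleton 0)),
    (hc.rev n).lintegral_encard hr n measurableSet_Icc]
  refine setLIntegral_congr ?_
  exact (sdiff_null_ae_eq_self (by simp)).trans Ioo_ae_eq_Icc

theorem IsEnsemble.tendsto_lintegral_encard (hc : IsEnsemble P c r) (hr : AdmissibleDensity r a) :
    Tendsto (fun n : ℕ => ENNReal.ofReal (1 / Real.sqrt n) *
      ∫⁻ ω, ((realZeros (fun k => c k ω) n).encard : ENNReal) ∂P) atTop (𝓝 1) := by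
  have h1 := hr.tendsto_encard_Icc (P := P) (C := fun _ => c) fun _ => hc
  -- The reversed ensemble depends on `n`, which is why the limit on `[-1, 1]` is available for
  -- sequences of ensembles.
  have h2 := hr.tendsto_encard_Icc (P := P) (C := fun n k => c (revIndex n k)) fun n => hc.rev n
  have h3 := h1.add h2
  rw [← ENNReal.ofReal_add (by norm_num) (by norm_num), add_halves, ENNReal.ofReal_one] at h3
  refine h3.congr fun n => ?_
  rw [← hc.lintegral_encard_outer hr n, ← mul_add,
    ← lintegral_add_left' (hc.aemeasurable_encard n measurableSet_Icc)]
  congr 1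
  refine lintegral_congr fun ω => ?_
  rw [← ENat.toENNReal_add, ← Set.encard_union_eq, ← Set.union_inter_distrib_right,
    Set.union_compl_self, Set.univ_inter]
  exact (disjoint_compl_right.mono Set.inter_subset_left Set.inter_subset_left)

theorem IsEnsemble.lintegral_encard_lt_top (hc : IsEnsemble P c r) (n : ℕ) :
    ∫⁻ ω, ((realZeros (fun k => c k ω) n).encard : ENNReal) ∂P < ⊤ := by
  have h : ∀ᵐ ω ∂P, ((realZeros (fun k => c k ω) n).encard : ENNReal) ≤ (n : ENNReal) := by
    filter_upwards [hc.ae_ne_zero 0] with ω hω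
    have := encard_realZeros_le (c := fun k => c k ω) hω n
    exact_mod_cast this
  refine (lintegral_mono_ae h).trans_lt ?_
  simp

theorem IsEnsemble.isRealZeroDensity_intensity (hc : IsEnsemble P c r)
    (hr : AdmissibleDensity r a) (n : ℕ) :
    IsRealZeroDensity P c n fun x => (intensity P c r n x).toReal := by
  refine ⟨(hc.measurable_intensity hr n).ennreal_toReal, fun _ => ENNReal.toReal_nonneg,
    fun B hB => ?_⟩
  rw [hc.lintegral_encard hr n hB]
  refine lintegral_congr fun x => (ENNReal.ofReal_toReal ?_).symm
  -- The intensity is finite at every point, so passing to real values loses nothing.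
  rw [intensity_eq_weightedDensity hc hr n x 0]
  exact ENNReal.ofReal_ne_top

/-- Both conventions assign `0` to an infinite set. -/
theorem toReal_toENNReal_encard (s : Set ℝ) : (s.encard : ENNReal).toReal = s.ncard := by
  rcases s.finite_or_infinite with h | h
  · rw [← h.cast_ncard_eq]; simp
  · rw [h.encard_eq, h.ncard]; simp

theorem IsEnsemble.integrable_ncard (hc : IsEnsemble P c r) (n : ℕ) :
    Integrable (fun ω => ((realZeros (fun k => c k ω) n).ncard : ℝ)) P := by
  simp_rw [← toReal_toENNReal_encard]
  exact integrable_toReal_of_lintegral_ne_top (hc.aemeasurable_encard_realZeros n)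
    (hc.lintegral_encard_lt_top n).ne

theorem IsEnsemble.integral_ncard (hc : IsEnsemble P c r) (n : ℕ) :
    ∫ ω, ((realZeros (fun k => c k ω) n).ncard : ℝ) ∂P =
      (∫⁻ ω, ((realZeros (fun k => c k ω) n).encard : ENNReal) ∂P).toReal := by
  simp_rw [← toReal_toENNReal_encard]
  exact integral_toReal (hc.aemeasurable_encard_realZeros n)
    (ae_lt_top' (hc.aemeasurable_encard_realZeros n) (hc.lintegral_encard_lt_top n).ne)

theorem IsEnsemble.tendsto_toReal (hc : IsEnsemble P c r) (hr : AdmissibleDensity r a) :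
    Tendsto (fun n : ℕ => (1 / Real.sqrt n) *
      (∫⁻ ω, ((realZeros (fun k => c k ω) n).encard : ENNReal) ∂P).toReal) atTop (𝓝 1) := by
  have h := (ENNReal.tendsto_toReal ENNReal.one_ne_top).comp (hc.tendsto_lintegral_encard hr)
  simpa [Function.comp_def, ENNReal.toReal_mul] using h

end Main

end SO2Ensemble

theorem theorem5p3 {Ω : Type*} [MeasurableSpace Ω] (P : Measure Ω) [IsProbabilityMeasure P]
    (c : ℕ → Ω → ℝ) (hmeas : ∀ k, Measurable (c k)) (hindep : iIndepFun c P)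
    (r : ℝ → ℝ) (hr_cont : Continuous r) (hr_nonneg : ∀ t, 0 ≤ r t)
    (hlaw : ∀ k, P.map (c k) = volume.withDensity (fun t => ENNReal.ofReal (r t)))
    (hmean : ∀ k, ∫ ω, c k ω ∂P = 0) (hvar : ∀ k, ∫ ω, c k ω ^ 2 ∂P = 1)
    (hφ : SO2Ensemble.CharFunBounds (charFun (P.map (c 0)))) :
    (∀ n, ∃ p : ℝ → ℝ, SO2Ensemble.IsRealZeroDensity P c n p) ∧
    (∀ p : ℕ → ℝ → ℝ, (∀ n, SO2Ensemble.IsRealZeroDensity P c n (p n)) →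
      (∀ n, Integrable (p n)) ∧
      Tendsto (fun n : ℕ => (1 / Real.sqrt n) * ∫ x, p n x) atTop (𝓝 1)) ∧
    (∀ n, Integrable
      (fun ω => ((SO2Ensemble.realZeros (fun k => c k ω) n).ncard : ℝ)) P) ∧
    Tendsto (fun n : ℕ => (1 / Real.sqrt n) *
      ∫ ω, ((SO2Ensemble.realZeros (fun k => c k ω) n).ncard : ℝ) ∂P) atTop (𝓝 1) := by
  obtain ⟨-, a, ha, A, -, hb⟩ := hφ
  have hc : SO2Ensemble.IsEnsemble P c r := ⟨hmeas, hindep, hlaw⟩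
  have hlaw0 : P.map (c 0) = SO2Ensemble.law r := hlaw 0
  have hm0 : AEMeasurable (c 0) P := (hmeas 0).aemeasurable
  have hr : SO2Ensemble.AdmissibleDensity r a := by
    refine ⟨hr_cont, hr_nonneg, ?_, ?_, ?_, ?_, ha, fun s => ?_⟩
    · rw [← hlaw0]
      exact Measure.isProbabilityMeasure_map hm0
    · rw [← hlaw0, memLp_map_measure_iff aestronglyMeasurable_id hm0, Function.id_comp,
        memLp_two_iff_integrable_sq hm0.aestronglyMeasurable]
      -- A nonzero Bochner integral forces integrability, so the unit second moment already gives
      -- membership in `L²`.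
      exact Integrable.of_integral_ne_zero (by rw [hvar 0]; exact one_ne_zero)
    · rw [← hlaw0, integral_map hm0 (by fun_prop)]
      exact hmean 0
    · rw [← hlaw0, integral_map hm0 (by fun_prop)]
      exact hvar 0
    · rw [← hlaw0]
      exact (hb s).1
  have hint : ∀ {n : ℕ} {p : ℝ → ℝ}, SO2Ensemble.IsRealZeroDensity P c n p → Integrable p := by
    intro n p hp
    refine ⟨hp.1.aestronglyMeasurable, ?_⟩
    rw [hasFiniteIntegral_iff_ofReal (ae_of_all _ hp.2.1),
      SO2Ensemble.lintegral_ofReal_eq_of_isRealZeroDensity hp]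
    exact hc.lintegral_encard_lt_top n
  refine ⟨fun n => ⟨_, hc.isRealZeroDensity_intensity hr n⟩, fun p hp => ⟨fun n => hint (hp n), ?_⟩,
    hc.integrable_ncard, ?_⟩
  · refine (hc.tendsto_toReal hr).congr fun n => ?_
    rw [← SO2Ensemble.lintegral_ofReal_eq_of_isRealZeroDensity (hp n),
      integral_eq_lintegral_of_nonneg_ae (ae_of_all _ (hp n).2.1) (hp n).1.aestronglyMeasurable]
  · simp_rw [hc.integral_ncard]
    exact hc.tendsto_toReal hr
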